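/- Let $h\ge 1$ and let $\Pi=\langle x_1,\dots,x_h \mid x_1^2x_2^2\cdots x_h^2=1\rangle$, which is the fundamental group of the closed non-orientable surface obtained as the connected sum of $h$ copies of $\mathbb{RP}^2$. Let $G$ be a complex reductive Lie group (not necessarily connected), that is, a complex Lie group isomorphic to a Zariski closed subgroup of some $GL_n(\mathbb C)$ with trivial unipotent radical. Let $\mathfrak g$ be its Lie algebra and $\mathrm{Ad}$ its adjoint representation. For a homomorphism $\phi\colon\Pi\to G$ let $\mathfrak g_{\mathrm{Ad}\circ\phi}$ be the vector space $\mathfrak g$ on which $\Pi$ acts through $\mathrm{Ad}\circ\phi$. Then for every $\phi\in\mathrm{Hom}(\Pi,G)$ the group cohomology satisfies $$H^0(\Pi,\mathfrak g_{\mathrm{Ad}\circ\phi})=\mathfrak g^{\Pi}=\bigcap_{i=1}^h\ker(\mathrm{Ad}_{\phi(x_i)}-1),$$ where $H^0$ is identified with the subspace $\mathfrak g^\Pi$ of $\Pi$-invariant vectors, and, if $h\ge 2$, there is an isomorphism of complex vector spaces $$H^2(\Pi,\mathfrak g_{\mathrm{Ad}\circ\phi})\cong\bigcap_{i=1}^h\ker(\mathrm{Ad}_{\phi(x_i)}+1).$$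 -/

import Mathlib

open scoped Manifold ContDiff

noncomputable section

/-! ### The adjoint representation of a complex Lie group -/

section Adjoint

variable (E : Type*) [NormedAddCommGroup E] [NormedSpace ℂ E]
  (G : Type*) [TopologicalSpace G] [ChartedSpace E G] [Group G]

/-- The differential at the identity of the conjugation `x ↦ g * x * g⁻¹`, as an endomorphism of
the Lie algebra (the tangent space of `G` at the identity). The tangent space at `g * 1 * g⁻¹`,
where the differential takes its values, is the tangent space at the identity. -/
def adLinear (g : G) : GroupLieAlgebra 𝓘(ℂ, E) G →ₗ[ℂ] GroupLieAlgebra 𝓘(ℂ, E) G where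
  toFun v := mfderiv 𝓘(ℂ, E) 𝓘(ℂ, E) (fun x : G => g * x * g⁻¹) 1 v
  map_add' v w := (mfderiv 𝓘(ℂ, E) 𝓘(ℂ, E) (fun x : G => g * x * g⁻¹) 1).map_add v w
  map_smul' c v := (mfderiv 𝓘(ℂ, E) 𝓘(ℂ, E) (fun x : G => g * x * g⁻¹) 1).map_smul c v

theorem adLinear_one : adLinear E G 1 = 1 := by
  have h : (fun x : G => 1 * x * 1⁻¹) = id := by ext x; simp
  ext v
  change mfderiv 𝓘(ℂ, E) 𝓘(ℂ, E) (fun x : G => 1 * x * 1⁻¹) 1 v = v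
  rw [h, mfderiv_id]
  rfl

theorem adLinear_mul [LieGroup 𝓘(ℂ, E) ω G] (a b : G) :
    adLinear E G (a * b) = adLinear E G a * adLinear E G b := by
  have hd : ∀ (g y : G), MDifferentiableAt 𝓘(ℂ, E) 𝓘(ℂ, E) (fun x : G => g * x * g⁻¹) y := by
    intro g y
    have hc : ContMDiff 𝓘(ℂ, E) 𝓘(ℂ, E) ω (fun x : G => g * x * g⁻¹) :=
      (contMDiff_mul_right (a := g⁻¹)).comp (contMDiff_mul_left (a := g))
    exact (hc y).mdifferentiableAt (by simp)
  have h : (fun x : G => a * b * x * (a * b)⁻¹)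
      = (fun x : G => a * x * a⁻¹) ∘ (fun x : G => b * x * b⁻¹) := by
    ext x; simp [mul_assoc]
  have h1 : b * 1 * b⁻¹ = (1 : G) := by simp
  ext v
  change mfderiv 𝓘(ℂ, E) 𝓘(ℂ, E) (fun x : G => a * b * x * (a * b)⁻¹) 1 v
    = mfderiv 𝓘(ℂ, E) 𝓘(ℂ, E) (fun x : G => a * x * a⁻¹) 1
      (mfderiv 𝓘(ℂ, E) 𝓘(ℂ, E) (fun x : G => b * x * b⁻¹) 1 v)
  rw [h, mfderiv_comp 1 (hd a _) (hd b _)]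
  change mfderiv 𝓘(ℂ, E) 𝓘(ℂ, E) (fun x : G => a * x * a⁻¹) (b * 1 * b⁻¹)
      (mfderiv 𝓘(ℂ, E) 𝓘(ℂ, E) (fun x : G => b * x * b⁻¹) 1 v) = _
  generalize mfderiv 𝓘(ℂ, E) 𝓘(ℂ, E) (fun x : G => b * x * b⁻¹) 1 v = w
  revert w
  rw [h1]
  intro w
  rfl

/-- The adjoint representation `Ad` of a complex Lie group on its Lie algebra. -/
def adjointRep [LieGroup 𝓘(ℂ, E) ω G] : Representation ℂ G (GroupLieAlgebra 𝓘(ℂ, E) G) where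
  toFun := adLinear E G
  map_one' := adLinear_one E G
  map_mul' := adLinear_mul E G

end Adjoint

/-! ### Complex reductive groups -/

/-- A subgroup of `GL_n(ℂ)` is Zariski closed if it is the zero locus in `GL_n(ℂ)` of a set of
polynomials in the matrix entries. -/
def IsZariskiClosed {n : ℕ} (H : Subgroup (GL (Fin n) ℂ)) : Prop :=
  ∃ S : Set (MvPolynomial (Fin n × Fin n) ℂ), ∀ g : GL (Fin n) ℂ,
    g ∈ H ↔ ∀ p ∈ S, MvPolynomial.eval (fun ij => (g : Matrix (Fin n) (Fin n) ℂ) ij.1 ij.2) p = 0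

/-- A reductive linear algebraic group over `ℂ`: a Zariski closed subgroup of `GL_n(ℂ)` with
trivial unipotent radical, that is, whose only Zariski closed normal subgroup consisting of
unipotent matrices is the trivial one (in characteristic zero such subgroups are connected). -/
structure IsReductiveLinearGroup {n : ℕ} (H : Subgroup (GL (Fin n) ℂ)) : Prop where
  isZariskiClosed : IsZariskiClosed H
  eq_bot_of_unipotent : ∀ U : Subgroup (GL (Fin n) ℂ), U ≤ H → IsZariskiClosed U →
    (∀ h ∈ H, ∀ u ∈ U, h * u * h⁻¹ ∈ U) →
    (∀ u ∈ U, IsNilpotent ((u : Matrix (Fin n) (Fin n) ℂ) - 1)) → U = ⊥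

/-- A complex reductive Lie group: a complex Lie group `G` that is isomorphic, as a complex Lie
group, to a reductive linear algebraic group over `ℂ`. The isomorphism is given as a
homomorphism `ρ` into some `GL_n(ℂ)` that is an embedding of complex manifolds (a topological
embedding which is holomorphic and has injective differential; for a homomorphism it is enough to
ask the latter at the identity) and whose range is such a group. No connectedness is assumed. -/
def IsComplexReductive (E : Type*) [NormedAddCommGroup E] [NormedSpace ℂ E]
    (G : Type*) [TopologicalSpace G] [ChartedSpace E G] [Group G] : Prop :=
  ∃ (n : ℕ) (ρ : G →* GL (Fin n) ℂ),
    Topology.IsEmbedding ρ ∧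
    (∀ i j, ContMDiff 𝓘(ℂ, E) 𝓘(ℂ, ℂ) ω
      (fun g : G => (ρ g : Matrix (Fin n) (Fin n) ℂ) i j)) ∧
    (∀ v : GroupLieAlgebra 𝓘(ℂ, E) G,
      (∀ i j, mfderiv 𝓘(ℂ, E) 𝓘(ℂ, ℂ)
        (fun g : G => (ρ g : Matrix (Fin n) (Fin n) ℂ) i j) 1 v = 0) → v = 0) ∧
    IsReductiveLinearGroup ρ.range

/-! ### Fundamental groups of closed non-orientable surfaces -/

/-- The word `x₁² x₂² ⋯ x_h²` in the free group on `x₁, …, x_h`. -/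
def surfaceRelator (h : ℕ) : FreeGroup (Fin h) :=
  (List.ofFn fun i : Fin h => FreeGroup.of i ^ 2).prod

/-- The group `Π` is generated by `x₁, …, x_h` subject to the single relation
`x₁² x₂² ⋯ x_h² = 1`: this is the fundamental group of the connected sum of `h` copies of the
real projective plane, with its standard generators. -/
structure IsNonorientableSurfaceGroup {Γ : Type*} [Group Γ] {h : ℕ} (x : Fin h → Γ) : Prop where
  generates : Function.Surjective (FreeGroup.lift x)
  relations : (FreeGroup.lift x).ker = Subgroup.normalClosure {surfaceRelator h}

end

/-! Degree zero is formal: a vector fixed by the generators is fixed by the group they generate.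

In degree two write `V` for the Lie algebra and `Γ = F/⟨⟨r⟩⟩` with `F` free. Since `H²(F) = 0`, a
2-cocycle of `Γ` pulled back to `F` is the coboundary of some `β`, unique up to a derivation. So the
normalised value of `β` at `r` is well defined modulo the values at `r` of derivations `F → V`, and
the cocycle is a coboundary exactly when this class vanishes (`IsTransgression.coboundary_iff`).
Because `r` is a product of squares, those values fill `∑ im(ρ(x_i) + 1)`. Every vector arises from
a cocycle when `h ≥ 2`: an amalgam of two copies of `V ⋊ F` contains `V` and gives `r` any
prescribed value (`exists_group_relator_eq`). Hence `H² ≅ V / ∑ im(ρ(x_i) + 1)`, for every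
representation.

Reductivity turns this cokernel into a kernel. For a nondegenerate invariant form, the orthogonal of
`im(g + 1)` is `ker(g + 1)`. The form used is `tr(dρ(v) dρ(w))` for a faithful matrix
representation. Its radical consists of nilpotent matrices, by Chevalley's replicas
(`eval_exp_replica_eq_zero`). Engel's theorem then yields a chain of subspaces ending in zero, and
the group elements acting trivially on its successive quotients form a Zariski closed normal
unipotent subgroup. That subgroup is trivial by reductivity, yet contains the exponentials of the
radical, so the radical is zero. The argument is run on the matrices `X` with all `exp(tX)` in the
group; the two inclusions identifying them with the image of `dρ` are
`isOneParameterGenerator_matrixDifferential` and `mem_range_matrixDifferential`. -/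

/-! ### Cohomology of one-relator groups in low degrees -/

section Derivations

variable {k V G : Type*} [CommRing k] [AddCommGroup V] [Module k V] [Group G]

/-- A representation, viewed as an action by automorphisms on the underlying group written
multiplicatively. -/
def Representation.toMulAut (ρ : Representation k G V) : G →* MulAut (Multiplicative V) where
  toFun g :=
    { toFun := fun m => Multiplicative.ofAdd (ρ g m.toAdd)
      invFun := fun m => Multiplicative.ofAdd (ρ g⁻¹ m.toAdd)
      left_inv := fun m => by simp
      right_inv := fun m => by simp
      map_mul' := fun m n => by simp }
  map_one' := by ext m; simp
  map_mul' g h := by ext m; simp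

@[simp]
theorem Representation.toMulAut_apply (ρ : Representation k G V) (g : G) (m : Multiplicative V) :
    ρ.toMulAut g m = Multiplicative.ofAdd (ρ g m.toAdd) := rfl

/-- A derivation (crossed homomorphism) with values in a representation. -/
def Representation.IsDerivation (ρ : Representation k G V) (D : G → V) : Prop :=
  ∀ u v, D (u * v) = ρ u (D v) + D u

theorem Representation.IsDerivation.map_one {ρ : Representation k G V} {D : G → V}
    (hD : ρ.IsDerivation D) : D 1 = 0 := by
  have := hD 1 1
  simpa using this

/-- Derivations on a free group can be prescribed arbitrarily on the generators. -/
theorem FreeGroup.exists_isDerivation {ι : Type*} (ρ : Representation k (FreeGroup ι) V)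
    (m : ι → V) : ∃ D : FreeGroup ι → V, ρ.IsDerivation D ∧ ∀ i, D (FreeGroup.of i) = m i := by
  -- The left component of a homomorphism to the semidirect product that lifts the identity is a
  -- derivation.
  let ψ : FreeGroup ι →* Multiplicative V ⋊[ρ.toMulAut] FreeGroup ι :=
    FreeGroup.lift fun i => ⟨Multiplicative.ofAdd (m i), FreeGroup.of i⟩
  have hr : ∀ u, (ψ u).right = u := by
    have : SemidirectProduct.rightHom.comp ψ = MonoidHom.id _ := by
      ext i; simp [ψ]
    intro u
    exact DFunLike.congr_fun this u
  refine ⟨fun u => (ψ u).left.toAdd, fun u v => ?_, fun i => by simp [ψ]⟩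
  simp [hr, add_comm]

/-- The action on functions from a group to a representation by translation and by the
representation. -/
def Representation.funRep (ρ : Representation k G V) : Representation k G (G → V) where
  toFun g :=
    { toFun := fun m h => ρ g (m (g⁻¹ * h))
      map_add' := fun m n => by ext h; simp
      map_smul' := fun c m => by ext h; simp }
  map_one' := by ext m; simp
  map_mul' g h := LinearMap.ext fun m => by ext j; simp [mul_assoc]

@[simp]
theorem Representation.funRep_apply (ρ : Representation k G V) (g : G) (m : G → V) (h : G) :
    ρ.funRep g m h = ρ g (m (g⁻¹ * h)) := rfl

/-- The second cohomology of a free group vanishes. -/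
theorem FreeGroup.exists_cochain_of_cocycle {ι : Type*} (ρ : Representation k (FreeGroup ι) V)
    (c : FreeGroup ι → FreeGroup ι → V)
    (hc : ∀ u v w, c (u * v) w + c u v = ρ u (c v w) + c u (v * w)) :
    ∃ β : FreeGroup ι → V, ∀ u v, β (u * v) = ρ u (β v) + β u + c u v := by
  -- In the function module, the cocycle identity says that `u ↦ (h ↦ c u (u⁻¹ * h))` splits `c` up
  -- to sign. Correcting it by a derivation `B` with the same values on generators gives a splitting
  -- `δ` that vanishes on generators, so every `δ u` is constant in `h` and the splitting takes
  -- values in `V`.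
  obtain ⟨B, hB, hBi⟩ := FreeGroup.exists_isDerivation ρ.funRep
    (fun i h => c (FreeGroup.of i) ((FreeGroup.of i)⁻¹ * h))
  let δ : FreeGroup ι → FreeGroup ι → V := fun u h => B u h - c u (u⁻¹ * h)
  have hδ : ∀ u v h, δ (u * v) h = ρ u (δ v (u⁻¹ * h)) + δ u h + c u v := by
    intro u v h
    have h1 := hc u v (v⁻¹ * (u⁻¹ * h))
    have h2 := congrFun (hB u v) h
    simp only [Pi.add_apply, Representation.funRep_apply] at h2
    simp only [mul_inv_cancel_left] at h1
    simp only [δ, h2, mul_inv_rev, map_sub, mul_assoc, eq_sub_of_add_eq h1]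
    abel
  have h1 : ∀ h, δ 1 h = - c 1 1 := by
    intro h
    have := hδ 1 1 h
    rw [mul_one, _root_.map_one, Module.End.one_apply, inv_one, one_mul, add_assoc] at this
    exact eq_neg_of_add_eq_zero_left (left_eq_add.1 this)
  have hconst : ∀ u h h', δ u h = δ u h' := by
    have hinv : ∀ u, (∀ h h', δ u h = δ u h') → ∀ h h', δ u⁻¹ h = δ u⁻¹ h' := by
      intro u hu h h'
      have key : ∀ h, δ u⁻¹ h = - ρ u⁻¹ (δ u 1) - c 1 1 - c u⁻¹ u := by
        intro h
        have := hδ u⁻¹ u h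
        rw [inv_mul_cancel, h1, hu _ 1] at this
        rw [← sub_eq_zero] at this ⊢
        rw [← neg_eq_zero, ← this]
        abel
      rw [key, key]
    intro u
    induction u using FreeGroup.induction_on with
    | C1 => intro h h'; rw [h1, h1]
    | of i => intro h h'; simp [δ, hBi]
    | inv_of i hi => exact hinv _ hi
    | mul u v hu hv =>
      intro h h'
      rw [hδ, hδ, hu h h', hv (u⁻¹ * h) (u⁻¹ * h')]
  refine ⟨fun u => δ u 1, fun u v => ?_⟩
  change δ (u * v) 1 = _
  rw [hδ, hconst v _ 1]

end Derivations

/-! ### Values of derivations at a product of squares -/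

section Relator

variable {k V G : Type*} [CommRing k] [AddCommGroup V] [Module k V] [Group G]

/-- The value at `y₁² ⋯ y_n²` of a derivation, as a function of the operators `S i = ρ (y i)`
and of the values `m i` of the derivation at `y i`. -/
def derivSqProd : ∀ {n : ℕ}, (Fin n → Module.End k V) → (Fin n → V) → V
  | 0, _, _ => 0
  | _ + 1, S, m => (S 0 ^ 2) (derivSqProd (fun i => S i.succ) fun i => m i.succ) + (S 0 + 1) (m 0)

theorem Representation.IsDerivation.map_prod_sq {ρ : Representation k G V} {D : G → V}
    (hD : ρ.IsDerivation D) : ∀ {n : ℕ} (y : Fin n → G),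
    D (List.ofFn fun i => y i ^ 2).prod = derivSqProd (fun i => ρ (y i)) (fun i => D (y i))
  | 0, _ => by simp [derivSqProd, hD.map_one]
  | n + 1, y => by
    rw [List.ofFn_succ, List.prod_cons, hD, hD.map_prod_sq fun i => y i.succ, pow_two, hD (y 0)]
    simp [derivSqProd, pow_two]

theorem iSup_fin_succ {α : Type*} [CompleteLattice α] {n : ℕ} (f : Fin (n + 1) → α) :
    ⨆ i, f i = f 0 ⊔ ⨆ i : Fin n, f i.succ := by
  refine le_antisymm (iSup_le fun i => ?_) (sup_le (le_iSup f 0) (iSup_le fun i => le_iSup f _))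
  induction i using Fin.cases with
  | zero => exact le_sup_left
  | succ i => exact le_sup_of_le_right (le_iSup (fun i : Fin n => f i.succ) i)

/-- As `S² - 1 = (S + 1)(S - 1)`, the operator `S²` is the identity modulo the range of `S + 1`, so
the twists in front of the later terms do not change the span. -/
theorem exists_derivSqProd_eq_iff : ∀ {n : ℕ} (S : Fin n → Module.End k V) (a : V),
    (∃ m, derivSqProd S m = a) ↔ a ∈ ⨆ i, LinearMap.range (S i + 1)
  | 0, S, a => by
    rw [iSup_of_empty, Submodule.mem_bot]
    simp [derivSqProd, eq_comm]
  | n + 1, S, a => by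
    have key : ∀ v, (S 0 ^ 2) v = v + (S 0 + 1) (S 0 v - v) := by
      intro v
      simp [pow_two]
    rw [iSup_fin_succ, Submodule.mem_sup]
    constructor
    · rintro ⟨m, rfl⟩
      refine ⟨(S 0 + 1) (m 0 + (S 0 (derivSqProd (fun i => S i.succ) fun i => m i.succ) -
        derivSqProd (fun i => S i.succ) fun i => m i.succ)), ⟨_, rfl⟩, _,
        (exists_derivSqProd_eq_iff (fun i => S i.succ) _).1 ⟨fun i => m i.succ, rfl⟩, ?_⟩
      rw [derivSqProd, key, map_add]
      abel
    · rintro ⟨_, ⟨b, rfl⟩, a', ha', rfl⟩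
      obtain ⟨m, hm⟩ := (exists_derivSqProd_eq_iff _ _).2 ha'
      -- The subtracted term cancels the correction `(S 0 + 1) (S 0 a' - a')` produced by `key`.
      refine ⟨Fin.cons (b - (S 0 a' - a')) m, ?_⟩
      simp only [derivSqProd, Fin.cons_zero, Fin.cons_succ, hm, key]
      rw [map_sub]
      abel_nf
      simp only [map_add, map_zsmul]
      abel

end Relator

/-! ### Realising a prescribed value of the relator in an amalgam -/

section Twist

universe u

variable {k : Type*} {V : Type u} [CommRing k] [AddCommGroup V] [Module k V]

theorem SemidirectProduct.mul_inl_eq {N H : Type*} [CommGroup N] [Group H] {α : H →* MulAut N}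
    (t : N ⋊[α] H) (v : N) : t * inl v = inl (α t.right v) * t := by
  ext
  · simp [mul_comm]
  · simp

/-- Sending every generator to `1 ∈ ℤ` gives the word degree `2n ≠ 0`. -/
theorem FreeGroup.zpow_prod_sq_eq_one {ι : Type*} {n : ℕ} (hn : n ≠ 0) (e : Fin n → ι) (z : ℤ)
    (hz : (List.ofFn fun i => FreeGroup.of (e i) ^ 2).prod ^ z = 1) : z = 0 := by
  let f : FreeGroup ι →* Multiplicative ℤ := FreeGroup.lift fun _ => Multiplicative.ofAdd 1
  have h := congrArg f hz
  rw [map_zpow, map_list_prod, List.map_ofFn] at h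
  have h2 : (f ∘ fun i => FreeGroup.of (e i) ^ 2) = fun _ => Multiplicative.ofAdd (2 : ℤ) := by
    ext i
    simp [f, ← ofAdd_add, pow_two]
  rw [h2, List.ofFn_const, List.prod_replicate, _root_.map_one] at h
  have h3 := congrArg Multiplicative.toAdd h
  simpa [hn] using h3

/-- There is a group containing the representation `V` in which the relator `x₁² ⋯ x_h²` takes a
prescribed value `a` in `V`, namely the amalgam of two copies of the semidirect product of `V` by
the free group along the subgroups generated by `V` and by `x₁²`, respectively by `V` and by
`a (x₂² ⋯ x_h²)⁻¹`. -/
theorem exists_group_relator_eq {h : ℕ} (hh : 2 ≤ h) (ρ : Representation k (FreeGroup (Fin h)) V)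
    (hρ : ρ (surfaceRelator h) = 1) (a : V) :
    ∃ (E : Type u) (_ : Group E) (ι : Multiplicative V →* E) (ψ : FreeGroup (Fin h) →* E),
      Function.Injective ι ∧
      (∀ u v, ψ u * ι v = ι (Multiplicative.ofAdd (ρ u v.toAdd)) * ψ u) ∧
      ψ (surfaceRelator h) = ι (Multiplicative.ofAdd a) := by
  obtain ⟨n, rfl⟩ : ∃ n, h = n + 1 := ⟨h - 1, by omega⟩
  have hn : n ≠ 0 := by omega
  let x : Fin (n + 1) → FreeGroup (Fin (n + 1)) := FreeGroup.of
  let tail : FreeGroup (Fin (n + 1)) := (List.ofFn fun i : Fin n => x i.succ ^ 2).prod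
  have hr : surfaceRelator (n + 1) = x 0 ^ 2 * tail := by
    simp [surfaceRelator, List.ofFn_succ, tail, x]
  have hact : ρ (x 0 ^ 2) = ρ tail⁻¹ := by
    have h1 : ρ (x 0 ^ 2) * ρ tail = 1 := by rw [← map_mul, ← hr, hρ]
    have h2 : ρ tail * ρ tail⁻¹ = 1 := by rw [← map_mul, mul_inv_cancel, map_one]
    exact left_inv_eq_right_inv h1 h2
  let P := Multiplicative V ⋊[ρ.toMulAut] FreeGroup (Fin (n + 1))
  -- Gluing `x 0 ^ 2` in one copy to `a * tail⁻¹` in the other forces `x 0 ^ 2 * tail = a`. By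
  -- `hact` the two elements act alike on `V`, so each generates with `V` a quotient of the same `V
  -- ⋊ ℤ`.
  let t : Bool → P := fun i => cond i ⟨Multiplicative.ofAdd a, tail⁻¹⟩ ⟨1, x 0 ^ 2⟩
  have ht : ∀ i, ρ (t i).right = ρ (x 0 ^ 2) := by
    rintro (_ | _)
    · rfl
    · exact hact.symm
  let α : Multiplicative ℤ →* MulAut (Multiplicative V) :=
    ρ.toMulAut.comp (zpowersHom (FreeGroup (Fin (n + 1))) (x 0 ^ 2))
  have hright : ∀ i (z : ℤ), (t i ^ z).right = (t i).right ^ z := fun i z =>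
    map_zpow (SemidirectProduct.rightHom : P →* FreeGroup (Fin (n + 1))) (t i) z
  have hcompat : ∀ (i : Bool) (z : Multiplicative ℤ),
      (SemidirectProduct.inl : Multiplicative V →* P).comp (α z).toMonoidHom =
      (MulAut.conj (zpowersHom P (t i) z)).toMonoidHom.comp SemidirectProduct.inl := by
    intro i z
    refine MonoidHom.ext fun v => ?_
    change SemidirectProduct.inl (α z v) =
      t i ^ z.toAdd * SemidirectProduct.inl v * (t i ^ z.toAdd)⁻¹
    rw [eq_mul_inv_iff_mul_eq, SemidirectProduct.mul_inl_eq, hright]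
    congr 2
    have h1 : ρ.toMulAut (t i).right = ρ.toMulAut (x 0 ^ 2) := by
      ext v
      rw [Representation.toMulAut_apply, ht]
      rfl
    simp only [α, MonoidHom.comp_apply, zpowersHom_apply, map_zpow, h1]
  let φ : ∀ _ : Bool, (Multiplicative V ⋊[α] Multiplicative ℤ) →* P := fun i =>
    SemidirectProduct.lift SemidirectProduct.inl (zpowersHom P (t i)) (hcompat i)
  -- Infinite order makes the maps from `V ⋊ ℤ` injective, hence `V` embeds in the amalgam. For
  -- `tail` this requires at least one square, which is where `2 ≤ h` enters.
  have hord : ∀ i (z : ℤ), (t i).right ^ z = 1 → z = 0 := by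
    rintro (_ | _) z hz
    · refine FreeGroup.zpow_prod_sq_eq_one one_ne_zero (fun _ : Fin 1 => (0 : Fin (n + 1))) z ?_
      simp only [List.ofFn_succ, List.ofFn_zero, List.prod_cons, List.prod_nil, mul_one]
      exact hz
    · refine FreeGroup.zpow_prod_sq_eq_one hn (fun i : Fin n => i.succ) z ?_
      have h1 : tail⁻¹ ^ z = 1 := hz
      rwa [inv_zpow, inv_eq_one] at h1
  have hφ : ∀ i, Function.Injective (φ i) := by
    intro i
    rw [injective_iff_map_eq_one]
    rintro ⟨b, z⟩ hbz
    have h1 : (SemidirectProduct.inl b * t i ^ z.toAdd : P) = 1 := hbz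
    have hz : z = 1 := by
      have h2 := congrArg SemidirectProduct.right h1
      rw [SemidirectProduct.mul_right, SemidirectProduct.right_inl, one_mul, hright] at h2
      exact Multiplicative.toAdd.injective (hord i _ h2)
    subst hz
    rw [toAdd_one, zpow_zero, mul_one] at h1
    rw [SemidirectProduct.inl_injective (h1.trans (map_one _).symm)]
    rfl
  let ofE : Bool → P →* Monoid.PushoutI φ := fun i => Monoid.PushoutI.of (φ := φ) i
  have hofE : ∀ i v, ofE i (SemidirectProduct.inl v) =
      Monoid.PushoutI.base φ (SemidirectProduct.inl v) := by
    intro i v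
    rw [← Monoid.PushoutI.of_apply_eq_base φ i]
    simp [φ, ofE]
  let ψ : FreeGroup (Fin (n + 1)) →* Monoid.PushoutI φ := FreeGroup.lift
    (Fin.cases (ofE false (SemidirectProduct.inr (x 0)))
      fun i => ofE true (SemidirectProduct.inr (x i.succ)))
  refine ⟨Monoid.PushoutI φ, inferInstance,
    (Monoid.PushoutI.base φ).comp SemidirectProduct.inl, ψ, ?_, ?_, ?_⟩
  · exact (Monoid.PushoutI.base_injective hφ).comp SemidirectProduct.inl_injective
  · intro u v
    simp only [MonoidHom.comp_apply]
    induction u using FreeGroup.induction_on generalizing v with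
    | C1 => simp
    | of i =>
      have key : ∀ (b : Bool) (i : Fin (n + 1)), ofE b (SemidirectProduct.inr (x i)) *
          Monoid.PushoutI.base φ (SemidirectProduct.inl v) = Monoid.PushoutI.base φ
          (SemidirectProduct.inl (Multiplicative.ofAdd (ρ (x i) v.toAdd))) *
          ofE b (SemidirectProduct.inr (x i)) := by
        intro b i
        rw [← hofE b, ← hofE b, ← map_mul, ← map_mul, SemidirectProduct.mul_inl_eq]
        rfl
      induction i using Fin.cases with
      | zero => simpa [ψ] using key false 0
      | succ i => simpa [ψ] using key true i.succ
    | inv_of i hi =>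
      rw [map_inv, inv_mul_eq_iff_eq_mul, ← mul_assoc, hi, mul_assoc, mul_inv_cancel, mul_one]
      simp
    | mul u w hu hw =>
      rw [map_mul, mul_assoc, hw, ← mul_assoc, hu, mul_assoc]
      simp
  · have hψ : ∀ i, ψ (x i) = Fin.cases (motive := fun _ => Monoid.PushoutI φ)
        (ofE false (SemidirectProduct.inr (x 0)))
        (fun i => ofE true (SemidirectProduct.inr (x i.succ))) i := fun i =>
      FreeGroup.lift_apply_of
    have htail : ψ tail = ofE true (SemidirectProduct.inr tail) := by
      simp only [tail, map_list_prod, List.map_ofFn]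
      congr 2
      funext i
      rw [Function.comp_apply, Function.comp_apply, map_pow, Function.comp_apply, map_pow,
        map_pow, hψ]
      rfl
    have h0 : ψ (x 0 ^ 2) = ofE true (t true) := by
      have h1 : ∀ i, ofE i (t i) =
          Monoid.PushoutI.base φ (SemidirectProduct.inr (Multiplicative.ofAdd 1)) := by
        intro i
        rw [← Monoid.PushoutI.of_apply_eq_base φ i]
        simp [φ, ofE]
      rw [h1, ← h1 false]
      have h2 : t false = SemidirectProduct.inr (x 0) ^ 2 := by
        rw [← map_pow]
        rfl
      rw [h2, map_pow, map_pow, hψ]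
      rfl
    rw [hr, map_mul, htail, h0, ← map_mul, MonoidHom.comp_apply, ← hofE true]
    congr 1
    ext
    · simp [t, P]
    · simp [t, P]

end Twist

/-- The restriction of a representation along a group homomorphism. -/
def Representation.restrict {k V G H : Type*} [CommRing k] [AddCommGroup V] [Module k V] [Group G]
    [Group H] (ρ : Representation k G V) (π : H →* G) : Representation k H V :=
  MonoidHom.comp ρ π

@[simp]
theorem Representation.restrict_apply {k V G H : Type*} [CommRing k] [AddCommGroup V] [Module k V]
    [Group G] [Group H] (ρ : Representation k G V) (π : H →* G) (u : H) :
    ρ.restrict π u = ρ (π u) := rfl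

/-! ### Transgression: from cocycles on the quotient to values at the relator -/

section Transgression

variable {k : Type*} {V : Type*} {Γ : Type*} [CommRing k] [AddCommGroup V] [Module k V] [Group Γ]
  {ι : Type*}

/-- The 2-cochain `c` on `Γ` becomes the coboundary of a function `β` on the free group which takes
the (normalised) value `a` at the word `r`. For a presentation `⟨ι ∣ r⟩` of `Γ` this relates the
class of `c` in the second cohomology to the class of `a` modulo the values at `r` of
derivations. -/
def IsTransgression (ρ : Representation k Γ V) (π : FreeGroup ι →* Γ) (r : FreeGroup ι)
    (c : Γ × Γ → V) (a : V) : Prop :=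
  ∃ β : FreeGroup ι → V, (∀ u v, β (u * v) = ρ (π u) (β v) + β u + c (π u, π v)) ∧
    β r + c (1, 1) = a

variable {ρ : Representation k Γ V} {π : FreeGroup ι →* Γ} {r : FreeGroup ι}

theorem IsTransgression.zero : IsTransgression ρ π r 0 0 :=
  ⟨0, by simp, by simp⟩

theorem IsTransgression.add {c d : Γ × Γ → V} {a b : V} (hc : IsTransgression ρ π r c a)
    (hd : IsTransgression ρ π r d b) : IsTransgression ρ π r (c + d) (a + b) := by
  obtain ⟨β, hβ, rfl⟩ := hc
  obtain ⟨γ, hγ, rfl⟩ := hd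
  refine ⟨β + γ, fun u v => ?_, ?_⟩
  · simp only [Pi.add_apply, hβ, hγ, map_add]
    abel
  · simp only [Pi.add_apply]
    abel

theorem IsTransgression.smul {c : Γ × Γ → V} {a : V} (t : k) (hc : IsTransgression ρ π r c a) :
    IsTransgression ρ π r (t • c) (t • a) := by
  obtain ⟨β, hβ, rfl⟩ := hc
  exact ⟨t • β, fun u v => by simp [hβ], by simp⟩

theorem exists_isTransgression {c : Γ × Γ → V}
    (hc : ∀ f g h, c (f * g, h) + c (f, g) = ρ f (c (g, h)) + c (f, g * h)) :
    ∃ a, IsTransgression ρ π r c a := by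
  obtain ⟨β, hβ⟩ := FreeGroup.exists_cochain_of_cocycle (ρ.restrict π)
    (fun u v => c (π u, π v)) fun u v w => by
      simpa only [map_mul, Representation.restrict_apply] using hc (π u) (π v) (π w)
  exact ⟨_, β, hβ, rfl⟩

theorem IsTransgression.cocycle {c : Γ × Γ → V} {a : V} (hπ : Function.Surjective π)
    (h : IsTransgression ρ π r c a) (f g j : Γ) :
    c (f * g, j) + c (f, g) = ρ f (c (g, j)) + c (f, g * j) := by
  obtain ⟨β, hβ, -⟩ := h
  obtain ⟨u, rfl⟩ := hπ f
  obtain ⟨v, rfl⟩ := hπ g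
  obtain ⟨w, rfl⟩ := hπ j
  have h1 := hβ (u * v) w
  have h2 := hβ u (v * w)
  rw [hβ u v, mul_assoc] at h1
  rw [hβ v w, h1] at h2
  simp only [map_mul, map_add, Module.End.mul_apply] at h2
  rw [← sub_eq_zero] at h2 ⊢
  rw [← h2]
  abel

/-- A group containing `V` in which the relator takes the value `a` gives rise to a cocycle. -/
theorem exists_isTransgression_of_group (hπ : Function.Surjective π)
    (hker : π.ker = Subgroup.normalClosure {r}) {E : Type*} [Group E]
    (i : Multiplicative V →* E) (ψ : FreeGroup ι →* E) (hi : Function.Injective i)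
    (hψ : ∀ u v, ψ u * i v = i (Multiplicative.ofAdd (ρ (π u) v.toAdd)) * ψ u) {a : V}
    (hr : ψ r = i (Multiplicative.ofAdd a)) :
    ∃ c : Γ × Γ → V, IsTransgression ρ π r c a := by
  -- The preimage of `V` under `ψ` is normal and contains `r`, hence contains the kernel of `π`.
  have hN : ∀ n, π n = 1 → ∃ v : V, ψ n = i (Multiplicative.ofAdd v) := by
    have hnormal : (i.range.comap ψ).Normal := by
      refine ⟨fun y hy g => ?_⟩
      obtain ⟨v, hv⟩ := hy
      refine ⟨Multiplicative.ofAdd (ρ (π g) v.toAdd), ?_⟩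
      rw [map_mul, map_mul, ← hv, hψ, mul_assoc, map_inv, mul_inv_cancel, mul_one]
    have hle : Subgroup.normalClosure {r} ≤ i.range.comap ψ :=
      Subgroup.normalClosure_le_normal (Set.singleton_subset_iff.2 ⟨_, hr.symm⟩)
    intro n hn
    obtain ⟨v, hv⟩ := hle (hker ▸ MonoidHom.mem_ker.2 hn)
    exact ⟨v.toAdd, hv.symm⟩
  -- For a set-theoretic section `σ`, the factor set of `ψ ∘ σ` is the cocycle, and `β` measures the
  -- difference between `ψ` and `ψ ∘ σ ∘ π`.
  choose σ hσ using hπ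
  have hβ : ∀ u, ∃ v : V, ψ u = i (Multiplicative.ofAdd v) * ψ (σ (π u)) := by
    intro u
    obtain ⟨v, hv⟩ := hN (u * (σ (π u))⁻¹) (by simp [hσ])
    exact ⟨v, by rw [← hv, map_mul, map_inv, inv_mul_cancel_right]⟩
  choose β hβ using hβ
  have hc : ∀ g : Γ × Γ, ∃ v : V,
      ψ (σ g.1) * ψ (σ g.2) = i (Multiplicative.ofAdd v) * ψ (σ (g.1 * g.2)) := by
    intro g
    obtain ⟨v, hv⟩ := hN (σ g.1 * σ g.2 * (σ (g.1 * g.2))⁻¹) (by simp [hσ])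
    exact ⟨v, by rw [← hv, map_mul, map_inv, map_mul, inv_mul_cancel_right]⟩
  choose c hc using hc
  refine ⟨c, β, fun u v => ?_, ?_⟩
  · have h1 : ψ (u * v) = i (Multiplicative.ofAdd (β u + ρ (π u) (β v) + c (π u, π v))) *
        ψ (σ (π (u * v))) := by
      rw [map_mul, hβ u, hβ v, mul_assoc, ← mul_assoc (ψ (σ (π u))), hψ, hσ, mul_assoc,
        hc (π u, π v), map_mul]
      simp [mul_assoc]
    rw [hβ] at h1
    have h2 := Multiplicative.ofAdd.injective (hi (mul_right_cancel h1))
    rw [h2]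
    abel
  · have hr1 : π r = 1 := by
      rw [← MonoidHom.mem_ker, hker]
      exact Subgroup.subset_normalClosure rfl
    have h1 := hβ r
    -- The section need not be normalised: `ψ (σ 1)` is the element `c (1, 1)` of `V`, whence the
    -- correction term in `IsTransgression`.
    have h2 := hc (1, 1)
    rw [mul_one, mul_left_inj] at h2
    rw [hr1, h2, hr, ← map_mul] at h1
    exact (Multiplicative.ofAdd.injective (hi h1)).symm

/-- If `b` splits `c`, then `β + b ∘ π` is a derivation, with the right value at `r` because `b 1 =
c (1, 1)`. Conversely, `γ = β - D` equals `-c (1, 1)` at `r`; the elements of the kernel with this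
property form a normal subgroup, so it is the whole kernel. Then `γ` factors through `π`, and minus
the induced function splits `c`. -/
theorem IsTransgression.coboundary_iff {c : Γ × Γ → V} {a : V} (hπ : Function.Surjective π)
    (hker : π.ker = Subgroup.normalClosure {r}) (h : IsTransgression ρ π r c a) :
    (∃ b : Γ → V, ∀ g j, ρ g (b j) - b (g * j) + b g = c (g, j)) ↔
      ∃ D : FreeGroup ι → V, (ρ.restrict π).IsDerivation D ∧
        D r = a := by
  have hr1 : π r = 1 := by
    rw [← MonoidHom.mem_ker, hker]
    exact Subgroup.subset_normalClosure rfl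
  have hcoc := h.cocycle hπ
  obtain ⟨β, hβ, rfl⟩ := h
  constructor
  · rintro ⟨b, hb⟩
    refine ⟨fun u => β u + b (π u), fun u v => ?_, ?_⟩
    · simp only [hβ, ← hb, Representation.restrict_apply, map_mul, map_add]
      abel
    · change β r + b (π r) = _
      rw [hr1, ← hb 1 1]
      simp
  · rintro ⟨D, hD, hDr⟩
    let γ : FreeGroup ι → V := fun u => β u - D u
    have hγ : ∀ u v, γ (u * v) = ρ (π u) (γ v) + γ u + c (π u, π v) := by
      intro u v
      simp only [γ, hβ, hD u v, map_sub, Representation.restrict_apply]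
      abel
    have hc1 : ∀ g, c (1, g) = c (1, 1) := by
      intro g
      have := hcoc 1 1 g
      simp only [one_mul, map_one, Module.End.one_apply] at this
      exact (add_right_injective _ this).symm
    have hc2 : ∀ g, c (g, 1) = ρ g (c (1, 1)) := by
      intro g
      have := hcoc g 1 1
      simp only [mul_one] at this
      exact add_left_injective _ this
    have hmul : ∀ n u, π n = 1 → γ n = - c (1, 1) → γ (n * u) = γ u := by
      intro n u hn hγn
      rw [hγ, hn, hc1, hγn]
      simp
    have hN : ∀ n, π n = 1 → γ n = - c (1, 1) := by
      have h1 : γ 1 = - c (1, 1) := by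
        have := hγ 1 1
        rw [mul_one, map_one, map_one, Module.End.one_apply, add_assoc] at this
        exact eq_neg_of_add_eq_zero_left (left_eq_add.1 this)
      let S : Subgroup (FreeGroup ι) :=
        { carrier := {n | π n = 1 ∧ γ n = - c (1, 1)}
          one_mem' := ⟨map_one π, h1⟩
          mul_mem' := fun {y z} hy hz =>
            ⟨by rw [map_mul, hy.1, hz.1, mul_one], by rw [hmul _ _ hy.1 hy.2, hz.2]⟩
          inv_mem' := fun {y} hy =>
            ⟨by rw [map_inv, hy.1, inv_one], by rw [← hmul y y⁻¹ hy.1 hy.2, mul_inv_cancel, h1]⟩ }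
      have hS : S.Normal := by
        refine ⟨fun y hy g => ?_⟩
        have hy1 : π (g * y * g⁻¹) = 1 := by simp [hy.1]
        refine ⟨hy1, ?_⟩
        have e1 := hγ g y
        have e2 := hγ (g * y * g⁻¹) g
        rw [inv_mul_cancel_right, e1, hy.2, hy1, hy.1, hc1 (π g), hc2 (π g), map_neg, map_one,
          Module.End.one_apply, neg_add_cancel_comm, add_assoc] at e2
        exact eq_neg_of_add_eq_zero_left (left_eq_add.1 e2)
      have hle : Subgroup.normalClosure {r} ≤ S := by
        refine Subgroup.normalClosure_le_normal (Set.singleton_subset_iff.2 ⟨hr1, ?_⟩)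
        simp only [γ, hDr]
        abel
      exact fun n hn => (hle (hker ▸ MonoidHom.mem_ker.2 hn)).2
    choose σ hσ using hπ
    have hfac : ∀ u, γ (σ (π u)) = γ u := by
      intro u
      have h1 : π (σ (π u) * u⁻¹) = 1 := by simp [hσ]
      rw [← hmul _ u h1 (hN _ h1), inv_mul_cancel_right]
    refine ⟨fun g => - γ (σ g), fun g j => ?_⟩
    have e := hγ (σ g) (σ j)
    rw [← hfac, map_mul, hσ, hσ] at e
    simp only [e, map_neg]
    abel

end Transgression

/-- A linear relation between two modules that is total on both sides, and that relates exactly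
the kernels of two surjections to each other, induces an isomorphism of the quotients. -/
theorem Submodule.nonempty_equiv_of_relation {k Z V M N : Type*} [Ring k]
    [AddCommGroup Z] [Module k Z] [AddCommGroup V] [Module k V]
    [AddCommGroup M] [Module k M] [AddCommGroup N] [Module k N] (R : Submodule k (Z × V))
    (q : Z →ₗ[k] M) (p : V →ₗ[k] N) (hq : Function.Surjective q) (hp : Function.Surjective p)
    (hR₁ : ∀ c, ∃ a, (c, a) ∈ R) (hR₂ : ∀ a, ∃ c, (c, a) ∈ R)
    (hR : ∀ c a, (c, a) ∈ R → (q c = 0 ↔ p a = 0)) : Nonempty (M ≃ₗ[k] N) := by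
  let f : R →ₗ[k] M := q ∘ₗ LinearMap.fst k _ _ ∘ₗ R.subtype
  let g : R →ₗ[k] N := p ∘ₗ LinearMap.snd k _ _ ∘ₗ R.subtype
  have hf : Function.Surjective f := fun y => by
    obtain ⟨c, rfl⟩ := hq y
    obtain ⟨a, ha⟩ := hR₁ c
    exact ⟨⟨_, ha⟩, rfl⟩
  have hg : Function.Surjective g := fun y => by
    obtain ⟨a, rfl⟩ := hp y
    obtain ⟨c, hc⟩ := hR₂ a
    exact ⟨⟨_, hc⟩, rfl⟩
  have hfg : LinearMap.ker f = LinearMap.ker g := by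
    ext ⟨⟨c, a⟩, hca⟩
    exact hR c a hca
  exact ⟨(f.quotKerEquivOfSurjective hf).symm ≪≫ₗ Submodule.quotEquivOfEq _ _ hfg ≪≫ₗ
    g.quotKerEquivOfSurjective hg⟩

/-! ### Cohomology of non-orientable surface groups -/

section SurfaceGroup

universe u

/-- The second cohomology of a non-orientable surface group other than that of the projective
plane. -/
theorem IsNonorientableSurfaceGroup.nonempty_H2_equiv {k V Γ : Type u} [CommRing k]
    [AddCommGroup V] [Module k V] [Group Γ] {h : ℕ} (hh : 2 ≤ h) {x : Fin h → Γ}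
    (hx : IsNonorientableSurfaceGroup x) (ρ : Representation k Γ V) :
    Nonempty (groupCohomology (Rep.of ρ) 2 ≃ₗ[k]
      V ⧸ ⨆ i, LinearMap.range (ρ (x i) + 1)) := by
  let π := FreeGroup.lift x
  have hπ : Function.Surjective π := hx.generates
  have hker : π.ker = Subgroup.normalClosure {surfaceRelator h} := hx.relations
  let W : Submodule k V := ⨆ i, LinearMap.range (ρ (x i) + 1)
  have hW : ∀ a, (∃ D : FreeGroup (Fin h) → V,
      (ρ.restrict π).IsDerivation D ∧ D (surfaceRelator h) = a) ↔
      a ∈ W := by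
    intro a
    rw [← exists_derivSqProd_eq_iff]
    constructor
    · rintro ⟨D, hD, rfl⟩
      refine ⟨fun i => D (FreeGroup.of i), ?_⟩
      rw [surfaceRelator, hD.map_prod_sq]
      simp [π]
    · rintro ⟨m, rfl⟩
      obtain ⟨D, hD, hm⟩ :=
        FreeGroup.exists_isDerivation (ρ.restrict π) m
      refine ⟨D, hD, ?_⟩
      rw [surfaceRelator, hD.map_prod_sq]
      simp [π, hm]
  let A := Rep.of ρ
  -- Only a relation: `β` may be changed by a derivation, so `c` determines `a` merely modulo `W`.
  let R : Submodule k (groupCohomology.cocycles₂ A × V) :=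
    { carrier := {p | IsTransgression ρ π (surfaceRelator h) p.1.1 p.2}
      zero_mem' := IsTransgression.zero
      add_mem' := IsTransgression.add
      smul_mem' := fun t _ hp => hp.smul t }
  refine R.nonempty_equiv_of_relation (groupCohomology.H2π A).hom W.mkQ
    ((ModuleCat.epi_iff_surjective _).1 inferInstance) W.mkQ_surjective (fun c => ?_)
    (fun a => ?_) fun c a hca => ?_
  · exact exists_isTransgression ((groupCohomology.mem_cocycles₂_iff c.1).1 c.2)
  · obtain ⟨E, _, i, ψ, hi, hψ, hr⟩ := exists_group_relator_eq hh (ρ.restrict π) (by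
      have : π (surfaceRelator h) = 1 := by
        rw [← MonoidHom.mem_ker, hker]
        exact Subgroup.subset_normalClosure rfl
      rw [Representation.restrict_apply, this, map_one]) a
    obtain ⟨c, hc⟩ := exists_isTransgression_of_group hπ hker i ψ hi hψ hr
    exact ⟨⟨c, (groupCohomology.mem_cocycles₂_iff (A := A) c).2 (hc.cocycle hπ)⟩, hc⟩
  · have h1 := (IsTransgression.coboundary_iff hπ hker hca).trans (hW a)
    have h2 : groupCohomology.H2π A c = 0 ↔ ⇑c ∈ groupCohomology.coboundaries₂ A :=
      groupCohomology.H2π_eq_zero_iff c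
    refine h2.trans (Iff.trans ?_ (h1.trans (Submodule.Quotient.mk_eq_zero W).symm))
    constructor
    · rintro ⟨b, hb⟩
      exact ⟨b, fun g j => congrFun hb (g, j)⟩
    · rintro ⟨b, hb⟩
      exact ⟨b, funext fun g => hb g.1 g.2⟩

theorem IsNonorientableSurfaceGroup.invariants_eq {k V Γ : Type*} [CommRing k]
    [AddCommGroup V] [Module k V] [Group Γ] {h : ℕ} {x : Fin h → Γ}
    (hx : IsNonorientableSurfaceGroup x) (ρ : Representation k Γ V) :
    ρ.invariants = ⨅ i, LinearMap.ker (ρ (x i) - 1) := by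
  ext v
  simp only [Representation.mem_invariants, Submodule.mem_iInf, LinearMap.mem_ker,
    LinearMap.sub_apply, Module.End.one_apply, sub_eq_zero]
  refine ⟨fun hv i => hv _, fun hv g => ?_⟩
  obtain ⟨u, rfl⟩ := hx.generates g
  induction u using FreeGroup.induction_on with
  | C1 => simp
  | of i => simpa using hv i
  | inv_of i hi =>
    rw [map_inv]
    conv_lhs => rw [← hi]
    simp
  | mul u w hu hw => rw [map_mul, map_mul, Module.End.mul_apply, hw, hu]

end SurfaceGroup

/-! ### Linear independence of exponential polynomials -/

noncomputable section ExponentialPolynomials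

open Polynomial

/-- Exponential polynomials `∑ q_μ(t) e^{μ t}`, as formal expressions. -/
abbrev ExpPoly : Type := AddMonoidAlgebra ℂ[X] ℂ

/-- Evaluation of the polynomial coefficients at `t`, and of the exponents by means of the
additive map `f`: the expression `∑ q_μ e^{μ}` is sent to `∑ q_μ(t) exp (f μ)`. -/
def ExpPoly.eval (t : ℂ) (f : ℂ →+ ℂ) : ExpPoly →+* ℂ :=
  AddMonoidAlgebra.liftNCRingHom (Polynomial.evalRingHom t)
    { toFun := fun μ => Complex.exp (f μ.toAdd)
      map_one' := by simp
      map_mul' := fun μ ν => by simp [Complex.exp_add] }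
    (fun _ _ => Commute.all _ _)

theorem ExpPoly.eval_single (t : ℂ) (f : ℂ →+ ℂ) (μ : ℂ) (q : ℂ[X]) :
    ExpPoly.eval t f (AddMonoidAlgebra.single μ q) = q.eval t * Complex.exp (f μ) := by
  simp [ExpPoly.eval]

/-- The space of smooth functions of a complex variable. -/
def smoothFunctions : Submodule ℂ (ℂ → ℂ) where
  carrier := {f | ContDiff ℂ ∞ f}
  zero_mem' := (contDiff_const : ContDiff ℂ ∞ fun _ : ℂ => (0 : ℂ))
  add_mem' hf hg := ContDiff.add (Set.mem_ofPred_eq.mp hf) (Set.mem_ofPred_eq.mp hg)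
  smul_mem' c _ hf := ContDiff.const_smul c (Set.mem_ofPred_eq.mp hf)

/-- Differentiation as an endomorphism of the space of smooth functions. -/
def smoothDeriv : Module.End ℂ smoothFunctions where
  toFun f := ⟨deriv f.1, (contDiff_infty_iff_deriv.1 f.2).2⟩
  map_add' f g := by
    ext t
    exact deriv_add ((contDiff_infty_iff_deriv.1 f.2).1 t) ((contDiff_infty_iff_deriv.1 g.2).1 t)
  map_smul' c f := by
    ext t
    exact deriv_const_smul c ((contDiff_infty_iff_deriv.1 f.2).1 t)

/-- The smooth function `q(t) e^{μ t}`. -/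
def polyMulExp (μ : ℂ) (q : ℂ[X]) : smoothFunctions :=
  ⟨fun t => q.eval t * Complex.exp (t * μ), by
    have h1 : ContDiff ℂ ∞ fun t => q.eval t := Polynomial.contDiff_aeval q _
    have h2 : ContDiff ℂ ∞ fun t : ℂ => Complex.exp (t * μ) := by fun_prop
    exact h1.mul h2⟩

/-- This puts `q(t) e^{μt}` in the generalised eigenspace of `d/dt` for `μ`, since iterated
derivatives of `q` vanish. -/
theorem smoothDeriv_polyMulExp (μ : ℂ) (q : ℂ[X]) :
    (smoothDeriv - algebraMap ℂ _ μ) (polyMulExp μ q) = polyMulExp μ (derivative q) := by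
  ext t
  have h := ((q.hasDerivAt t).mul (((hasDerivAt_id t).mul_const μ).cexp)).deriv
  change deriv (fun t => q.eval t * Complex.exp (t * μ)) t - μ * (q.eval t * Complex.exp (t * μ)) =
    (derivative q).eval t * Complex.exp (t * μ)
  refine (congrArg (· - _) h).trans ?_
  simp
  ring

theorem polyMulExp_mem (μ : ℂ) (q : ℂ[X]) :
    polyMulExp μ q ∈ smoothDeriv.maxGenEigenspace μ := by
  have hpow : ∀ n : ℕ, ((smoothDeriv - algebraMap ℂ _ μ) ^ n) (polyMulExp μ q) =
      polyMulExp μ (derivative^[n] q) := by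
    intro n
    induction n with
    | zero => rfl
    | succ n ih =>
      rw [pow_succ', Module.End.mul_apply, ih, smoothDeriv_polyMulExp, Function.iterate_succ_apply']
  rw [Module.End.mem_maxGenEigenspace]
  refine ⟨q.natDegree + 1, ?_⟩
  rw [← Algebra.algebraMap_eq_smul_one, hpow,
    Polynomial.iterate_derivative_eq_zero (Nat.lt_succ_self _)]
  ext t
  simp [polyMulExp]

/-- Exponential polynomials are determined by the functions they define. -/
theorem ExpPoly.eq_zero_of_eval (p : ExpPoly)
    (hp : ∀ t, ExpPoly.eval t (AddMonoidHom.mulLeft t) p = 0) : p = 0 := by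
  have hsum : ∑ μ ∈ p.coeff.support, polyMulExp μ (p.coeff μ) = 0 := by
    ext t
    have h1 : p = ∑ μ ∈ p.coeff.support, AddMonoidAlgebra.single μ (p.coeff μ) :=
      (AddMonoidAlgebra.sum_coeff_single p).symm
    have h2 := hp t
    rw [h1, map_sum] at h2
    simp only [ExpPoly.eval_single] at h2
    rw [AddSubmonoidClass.coe_finsetSum, Finset.sum_apply]
    exact h2
  have hzero : ∀ μ ∈ p.coeff.support, polyMulExp μ (p.coeff μ) = 0 := by
    intro μ hμ
    -- Generalised eigenspaces of `d/dt` are independent, so a vanishing sum vanishes exponent by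
    -- exponent.
    have hd := Module.End.independent_maxGenEigenspace smoothDeriv μ
    refine (Submodule.disjoint_def.1 hd) _ (polyMulExp_mem μ _) ?_
    rw [← Finset.add_sum_erase _ _ hμ] at hsum
    rw [eq_neg_of_add_eq_zero_left hsum]
    refine neg_mem (sum_mem fun ν hν => ?_)
    exact Submodule.mem_iSup_of_mem ν
      (Submodule.mem_iSup_of_mem (Finset.ne_of_mem_erase hν) (polyMulExp_mem ν _))
  refine AddMonoidAlgebra.ext (Finsupp.ext fun μ => ?_)
  by_contra hμ
  have h := hzero μ (Finsupp.mem_support_iff.2 hμ)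
  refine hμ (Polynomial.funext fun t => ?_)
  have h1 : (p.coeff μ).eval t * Complex.exp (t * μ) = 0 := congrFun (congrArg Subtype.val h) t
  simpa using (mul_eq_zero.1 h1).resolve_right (Complex.exp_ne_zero _)

end ExponentialPolynomials

/-! ### Chevalley's replicas -/

noncomputable section Replicas

open Matrix

variable {n : ℕ}

/-- `exp (t N)` for a nilpotent matrix `N`, as a polynomial in `t`. -/
def expNilpotent (N : Matrix (Fin n) (Fin n) ℂ) (K : ℕ) : Matrix (Fin n) (Fin n) ExpPoly :=
  ∑ j ∈ Finset.range K, AddMonoidAlgebra.single (0 : ℂ)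
    (Polynomial.C ((j.factorial : ℂ)⁻¹) * Polynomial.X ^ j) • (N ^ j).map (algebraMap ℂ ExpPoly)

theorem Matrix.exp_smul_eq_sum {N : Matrix (Fin n) (Fin n) ℂ} {K : ℕ} (hN : N ^ K = 0) (t : ℂ) :
    NormedSpace.exp (t • N) = ∑ j ∈ Finset.range K, ((j.factorial : ℂ)⁻¹ * t ^ j) • N ^ j := by
  rw [NormedSpace.exp_eq_tsum ℂ]
  change ∑' j : ℕ, (j.factorial : ℂ)⁻¹ • (t • N) ^ j = _
  rw [tsum_eq_sum (s := Finset.range K)]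
  · simp [smul_pow, smul_smul]
  · intro j hj
    rw [smul_pow, pow_eq_zero_of_le (by simpa using hj) hN, smul_zero, smul_zero]

theorem ExpPoly.eval_algebraMap (t : ℂ) (f : ℂ →+ ℂ) (z : ℂ) :
    ExpPoly.eval t f (algebraMap ℂ ExpPoly z) = z := by
  have : algebraMap ℂ ExpPoly z = AddMonoidAlgebra.single 0 (Polynomial.C z) := rfl
  rw [this, ExpPoly.eval_single]
  simp

theorem ExpPoly.mapMatrix_algebraMap (t : ℂ) (f : ℂ →+ ℂ) (M : Matrix (Fin n) (Fin n) ℂ) :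
    (ExpPoly.eval t f).mapMatrix (M.map (algebraMap ℂ ExpPoly)) = M := by
  ext i j
  exact ExpPoly.eval_algebraMap t f (M i j)

theorem ExpPoly.mapMatrix_expNilpotent (t : ℂ) (f : ℂ →+ ℂ) {N : Matrix (Fin n) (Fin n) ℂ} {K : ℕ}
    (hN : N ^ K = 0) :
    (ExpPoly.eval t f).mapMatrix (expNilpotent N K) = NormedSpace.exp (t • N) := by
  rw [Matrix.exp_smul_eq_sum hN, expNilpotent, map_sum]
  refine Finset.sum_congr rfl fun m _ => ?_
  ext i j
  simp [ExpPoly.eval_single]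
  ring

/-- If the one-parameter group generated by `X = N + Q diag(d) Q⁻¹` satisfies polynomial equations,
so do the one-parameter groups generated by the replicas `Q diag(f d) Q⁻¹` of its semisimple
part. -/
theorem eval_exp_replica_eq_zero (p : MvPolynomial (Fin n × Fin n) ℂ)
    (N : Matrix (Fin n) (Fin n) ℂ) (Q : (Matrix (Fin n) (Fin n) ℂ)ˣ) (d : Fin n → ℂ)
    (hN : IsNilpotent N)
    (hcomm : Commute N (Q * diagonal d * (↑Q⁻¹ : Matrix (Fin n) (Fin n) ℂ)))
    (hp : ∀ t : ℂ, MvPolynomial.eval (fun ij => NormedSpace.exp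
      (t • (N + Q * diagonal d * (↑Q⁻¹ : Matrix (Fin n) (Fin n) ℂ))) ij.1
        ij.2) p = 0)
    (f : ℂ →+ ℂ) :
    MvPolynomial.eval (fun ij => NormedSpace.exp
      (Q * diagonal (fun i => f (d i)) * (↑Q⁻¹ : Matrix (Fin n) (Fin n) ℂ)) ij.1
        ij.2) p = 0 := by
  obtain ⟨K, hK⟩ := hN
  -- `M` is a formal `exp(tX)`, with symbols for the exponentials of the eigenvalues. The polynomial
  -- `p` vanishes on its values at all `t`, hence on `M` itself, hence after any other evaluation.
  -- Taking `t = 0` removes the nilpotent factor, while the exponents may be sent through any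
  -- additive `f`.
  let D : Matrix (Fin n) (Fin n) ExpPoly := diagonal fun i => AddMonoidAlgebra.single (d i) 1
  let M : Matrix (Fin n) (Fin n) ExpPoly := expNilpotent N K *
    ((Q : Matrix (Fin n) (Fin n) ℂ).map (algebraMap ℂ ExpPoly) * D *
      ((Q⁻¹ : (Matrix (Fin n) (Fin n) ℂ)ˣ) : Matrix (Fin n) (Fin n) ℂ).map (algebraMap ℂ ExpPoly))
  have hM : ∀ (t : ℂ) (g : ℂ →+ ℂ), (ExpPoly.eval t g).mapMatrix M = NormedSpace.exp (t • N) *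
      NormedSpace.exp (Q * diagonal (fun i => g (d i)) * (Q⁻¹ : (Matrix (Fin n) (Fin n) ℂ)ˣ)) := by
    intro t g
    rw [map_mul, map_mul, map_mul, ExpPoly.mapMatrix_algebraMap, ExpPoly.mapMatrix_algebraMap,
      ExpPoly.mapMatrix_expNilpotent t g hK, Matrix.exp_units_conj, Matrix.exp_diagonal]
    congr 3
    ext i j
    by_cases hij : i = j
    · subst hij
      simp [D, ExpPoly.eval_single, Complex.exp_eq_exp_ℂ]
    · simp [D, hij]
  have hev : ∀ (t : ℂ) (g : ℂ →+ ℂ),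
      ExpPoly.eval t g (MvPolynomial.aeval (fun ij : Fin n × Fin n => M ij.1 ij.2) p) =
      MvPolynomial.eval (fun ij => (ExpPoly.eval t g).mapMatrix M ij.1 ij.2) p := by
    intro t g
    rw [MvPolynomial.aeval_def, MvPolynomial.hom_eval₂]
    have h1 : (ExpPoly.eval t g).comp (algebraMap ℂ ExpPoly) = RingHom.id ℂ := by
      ext z
      exact ExpPoly.eval_algebraMap t g z
    rw [h1]
    rfl
  have h0 : MvPolynomial.aeval (fun ij : Fin n × Fin n => M ij.1 ij.2) p = 0 := by
    refine ExpPoly.eq_zero_of_eval _ fun t => ?_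
    rw [hev, ← hp t, hM, smul_add, Matrix.exp_add_of_commute _ _ ((hcomm.smul_left t).smul_right t),
      ← smul_mul_assoc, ← mul_smul_comm, ← Matrix.diagonal_smul]
    rfl
  have h1 := hev 0 f
  rw [h0, map_zero, hM, zero_smul, NormedSpace.exp_zero, one_mul] at h1
  exact h1.symm

end Replicas

/-! ### Nilpotency of the trace radical -/

section TraceRadical

open Matrix

variable {n : ℕ}

/-- A semisimple complex matrix is diagonalizable. -/
theorem Matrix.exists_eq_conj_diagonal (A : Matrix (Fin n) (Fin n) ℂ)
    (hA : Module.End.IsSemisimple (toLin' A)) :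
    ∃ (Q : (Matrix (Fin n) (Fin n) ℂ)ˣ) (d : Fin n → ℂ),
      A = Q * diagonal d * ((Q⁻¹ : (Matrix (Fin n) (Fin n) ℂ)ˣ) : Matrix (Fin n) (Fin n) ℂ) := by
  classical
  let s : Module.End ℂ (Fin n → ℂ) := toLin' A
  let dec := DirectSum.isInternal_submodule_of_iSupIndep_of_iSup_eq_top
    s.eigenspaces_iSupIndep hA.iSup_eigenspace_eq_top
  let v := dec.collectedBasis fun μ => Module.finBasis ℂ (s.eigenspace μ)
  have : Fintype ((ν : ℂ) × Fin (Module.finrank ℂ (s.eigenspace ν))) :=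
    FiniteDimensional.fintypeBasisIndex v
  have hcard : Fintype.card ((ν : ℂ) × Fin (Module.finrank ℂ (s.eigenspace ν))) = n := by
    rw [← Module.finrank_eq_card_basis v, Module.finrank_fin_fun]
  let e := Fintype.equivFinOfCardEq hcard
  let b := v.reindex e
  let d : Fin n → ℂ := fun i => (e.symm i).1
  have hb : ∀ i, A *ᵥ b i = d i • b i := fun i => by
    have := Module.End.mem_eigenspace_iff.mp
      (dec.collectedBasis_mem (fun μ => Module.finBasis ℂ (s.eigenspace μ)) (e.symm i))
    rw [Module.Basis.reindex_apply]
    exact this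
  let P := Pi.basisFun ℂ (Fin n)
  let Q : (Matrix (Fin n) (Fin n) ℂ)ˣ :=
    ⟨P.toMatrix b, b.toMatrix P, P.toMatrix_mul_toMatrix_flip b, b.toMatrix_mul_toMatrix_flip P⟩
  refine ⟨Q, d, ?_⟩
  rw [Units.eq_mul_inv_iff_mul_eq]
  ext i j
  have h1 := congrFun (hb j) i
  rw [mul_diagonal]
  have h2 : ∀ k, (Q : Matrix (Fin n) (Fin n) ℂ) k j = b j k := fun k => rfl
  rw [h2, mul_apply]
  simp only [h2]
  rw [mul_comm]
  exact h1

/-- The matrices generating a complex one-parameter subgroup of `H`. -/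
def IsOneParameterGenerator (H : Subgroup (GL (Fin n) ℂ)) (X : Matrix (Fin n) (Fin n) ℂ) : Prop :=
  ∀ t : ℂ, ∃ g ∈ H, (g : Matrix (Fin n) (Fin n) ℂ) = NormedSpace.exp (t • X)

/-- Applying `f` to its own relation gives `∑ f(d_i)² = 0` in `ℚ`, so every rational functional
kills every `d_i`. -/
theorem eq_zero_of_forall_rat_linear (d : Fin n → ℂ)
    (hd : ∀ f : ℂ →ₗ[ℚ] ℚ, ∑ i, d i * (f (d i) : ℂ) = 0) : d = 0 := by
  funext i
  refine (Module.forall_dual_apply_eq_zero_iff ℚ (d i)).1 fun f => ?_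
  have h1 : ∑ i, f (d i) ^ 2 = 0 := by
    have h2 := congrArg f (hd f)
    rw [map_sum, map_zero] at h2
    rw [← h2]
    refine Finset.sum_congr rfl fun j _ => ?_
    have h3 : d j * (f (d j) : ℂ) = f (d j) • d j := by rw [Rat.smul_def, mul_comm]
    rw [h3, map_smul, smul_eq_mul, sq]
  exact pow_eq_zero_iff two_ne_zero |>.1
    ((Finset.sum_eq_zero_iff_of_nonneg fun _ _ => sq_nonneg _).1 h1 i (Finset.mem_univ i))

/-- In a Zariski closed group, a generator of a one-parameter subgroup that is orthogonal to all
of them for the trace form is nilpotent. -/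
theorem IsZariskiClosed.isNilpotent_of_trace_eq_zero {H : Subgroup (GL (Fin n) ℂ)}
    (hH : IsZariskiClosed H) {X : Matrix (Fin n) (Fin n) ℂ} (hX : IsOneParameterGenerator H X)
    (htr : ∀ Y, IsOneParameterGenerator H Y → trace (X * Y) = 0) : IsNilpotent X := by
  obtain ⟨S, hS⟩ := hH
  obtain ⟨N', hN'X, S', hS'X, hN', hS', hNS⟩ := 
    Module.End.exists_isNilpotent_isSemisimple (f := toLin' X)
  let N : Matrix (Fin n) (Fin n) ℂ := LinearMap.toMatrix' N'
  let A : Matrix (Fin n) (Fin n) ℂ := LinearMap.toMatrix' S'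
  have hXNA : X = N + A := by
    rw [← LinearMap.toMatrix'_toLin' X, hNS, map_add]
  have hN : IsNilpotent N := hN'.map LinearMap.toMatrixAlgEquiv'
  have hcomm : Commute N A := by
    have h1 : Commute N' S' := Algebra.commute_of_mem_adjoin_singleton_of_commute hS'X
      (Algebra.commute_of_mem_adjoin_self hN'X).symm
    exact h1.map LinearMap.toMatrixAlgEquiv'
  obtain ⟨Q, d, hQ⟩ := A.exists_eq_conj_diagonal (by rwa [toLin'_toMatrix'])
  suffices hd : d = 0 by
    have : A = 0 := by
      rw [hQ, hd]
      simp
    rwa [hXNA, this, add_zero]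
  refine eq_zero_of_forall_rat_linear d fun f => ?_
  -- The replica of the semisimple part with eigenvalues `f(d_i)`. It is orthogonal to `X` by `htr`,
  -- and the nilpotent part contributes nothing to the trace, leaving `∑ d_i f(d_i) = 0`.
  let Y : Matrix (Fin n) (Fin n) ℂ := Q * diagonal (fun i => (f (d i) : ℂ)) *
    ((Q⁻¹ : (Matrix (Fin n) (Fin n) ℂ)ˣ) : Matrix (Fin n) (Fin n) ℂ)
  have hY : IsOneParameterGenerator H Y := by
    intro s
    -- The scalar `s` is absorbed in the exponent map, which is additive but need not be `ℂ`-linear.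
    let g : ℂ →+ ℂ := (AddMonoidHom.mulLeft s).comp
      ((Rat.castHom ℂ).toAddMonoidHom.comp f.toAddMonoidHom)
    have hsY : s • Y = Q * diagonal (fun i => g (d i)) *
        ((Q⁻¹ : (Matrix (Fin n) (Fin n) ℂ)ˣ) : Matrix (Fin n) (Fin n) ℂ) := by
      rw [← smul_mul_assoc, ← mul_smul_comm, ← Matrix.diagonal_smul]
      rfl
    obtain ⟨u, hu⟩ := Matrix.isUnit_exp (s • Y)
    refine ⟨u, (hS u).2 fun p hp => ?_, hu⟩
    rw [hu, hsY]
    refine eval_exp_replica_eq_zero p N Q d hN (hQ ▸ hcomm) (fun t => ?_) g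
    rw [← hQ, ← hXNA]
    obtain ⟨h, hh, hht⟩ := hX t
    rw [← hht]
    exact (hS h).1 hh p hp
  -- In the eigenbasis `N` has nonzero entries only where `d_i = d_j`, and there `f(d_i) = f(d_j)`.
  have hNY : Commute N Y := by
    let M : Matrix (Fin n) (Fin n) ℂ :=
      ((Q⁻¹ : (Matrix (Fin n) (Fin n) ℂ)ˣ) : Matrix (Fin n) (Fin n) ℂ) * N * Q
    have hNM : N = Q * M * ((Q⁻¹ : (Matrix (Fin n) (Fin n) ℂ)ˣ) : Matrix (Fin n) (Fin n) ℂ) := by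
      simp [M, mul_assoc]
    have hconj : ∀ B C : Matrix (Fin n) (Fin n) ℂ,
        Q * B * ((Q⁻¹ : (Matrix (Fin n) (Fin n) ℂ)ˣ) : Matrix (Fin n) (Fin n) ℂ) * (Q * C *
          ((Q⁻¹ : (Matrix (Fin n) (Fin n) ℂ)ˣ) : Matrix (Fin n) (Fin n) ℂ)) =
        Q * (B * C) * ((Q⁻¹ : (Matrix (Fin n) (Fin n) ℂ)ˣ) : Matrix (Fin n) (Fin n) ℂ) := by
      intro B C
      simp [mul_assoc]
    have hMd : M * diagonal d = diagonal d * M := by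
      have h1 : N * A = A * N := hcomm
      rw [hQ, hNM, hconj, hconj, Units.mul_left_inj, Units.mul_right_inj] at h1
      exact h1
    change N * Y = Y * N
    rw [hNM, hconj, hconj]
    congr 2
    ext i j
    have h1 := congrFun (congrFun hMd i) j
    rw [mul_diagonal, diagonal_mul] at h1 ⊢
    rw [mul_comm] at h1
    by_cases h0 : M i j = 0
    · simp [h0]
    · rw [mul_right_cancel₀ h0 h1, mul_comm]
  have h1 := htr Y hY
  rw [hXNA, add_mul, trace_add,
    (isNilpotent_trace_of_isNilpotent (hNY.isNilpotent_mul_right hN)).eq_zero, zero_add, hQ] at h1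
  rw [← h1]
  have h2 : Q * diagonal d * ((Q⁻¹ : (Matrix (Fin n) (Fin n) ℂ)ˣ) : Matrix (Fin n) (Fin n) ℂ) * Y =
      Q * diagonal (fun i => d i * (f (d i) : ℂ)) *
      ((Q⁻¹ : (Matrix (Fin n) (Fin n) ℂ)ˣ) : Matrix (Fin n) (Fin n) ℂ) := by
    simp only [Y, mul_assoc, Units.inv_mul_cancel_left]
    rw [← mul_assoc (diagonal d), diagonal_mul_diagonal]
  rw [h2, trace_units_conj, trace_diagonal]

end TraceRadical

/-! ### Engel's theorem and the associated chain of subspaces -/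

section Unipotent

open Matrix

variable {n : ℕ}

/-- The descending chain of subspaces `W₀ = ℂⁿ`, `W_{k+1} = L W_k` attached to a space `L` of
matrices. -/
def actionSeries (L : Submodule ℂ (Matrix (Fin n) (Fin n) ℂ)) : ℕ → Submodule ℂ (Fin n → ℂ)
  | 0 => ⊤
  | k + 1 => Submodule.span ℂ {y | ∃ X ∈ L, ∃ w ∈ actionSeries L k, X *ᵥ w = y}

theorem mulVec_mem_actionSeries {L : Submodule ℂ (Matrix (Fin n) (Fin n) ℂ)}
    {X : Matrix (Fin n) (Fin n) ℂ} (hX : X ∈ L) {k : ℕ} {w : Fin n → ℂ}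
    (hw : w ∈ actionSeries L k) : X *ᵥ w ∈ actionSeries L (k + 1) :=
  Submodule.subset_span ⟨X, hX, w, hw, rfl⟩

theorem actionSeries_succ_le_iff {L : Submodule ℂ (Matrix (Fin n) (Fin n) ℂ)} {k : ℕ}
    {W : Submodule ℂ (Fin n → ℂ)} :
    actionSeries L (k + 1) ≤ W ↔ ∀ X ∈ L, ∀ w ∈ actionSeries L k, X *ᵥ w ∈ W := by
  rw [actionSeries, Submodule.span_le]
  exact ⟨fun h X hX w hw => h ⟨X, hX, w, hw, rfl⟩, fun h _ ⟨X, hX, w, hw, e⟩ => e ▸ h X hX w hw⟩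

theorem actionSeries_succ_le (L : Submodule ℂ (Matrix (Fin n) (Fin n) ℂ)) :
    ∀ k, actionSeries L (k + 1) ≤ actionSeries L k
  | 0 => le_top
  | k + 1 => actionSeries_succ_le_iff.2 fun _ hX _ hw =>
      mulVec_mem_actionSeries hX (actionSeries_succ_le L k hw)

attribute [local instance 100] LieRing.ofAssociativeRing

/-- **Engel's theorem** for a Lie algebra of nilpotent matrices. -/
theorem exists_actionSeries_eq_bot (L : Submodule ℂ (Matrix (Fin n) (Fin n) ℂ))
    (hL : ∀ X ∈ L, ∀ Y ∈ L, X * Y - Y * X ∈ L) (hnil : ∀ X ∈ L, IsNilpotent X) :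
    ∃ k, actionSeries L k = ⊥ := by
  let 𝔫 : LieSubalgebra ℂ (Module.End ℂ (Fin n → ℂ)) :=
    { L.map (toLinAlgEquiv' : Matrix (Fin n) (Fin n) ℂ ≃ₐ[ℂ] _).toLinearMap with
      lie_mem' := by
        rintro _ _ ⟨X, hX, rfl⟩ ⟨Y, hY, rfl⟩
        refine ⟨_, hL X hX Y hY, ?_⟩
        simp [LieRing.of_associative_ring_bracket] }
  have hN : LieModule.IsNilpotent 𝔫 (Fin n → ℂ) := by
    rw [LieModule.isNilpotent_iff_forall' (R := ℂ)]
    rintro ⟨_, X, hX, rfl⟩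
    exact (hnil X hX).map toLinAlgEquiv'
  obtain ⟨k, hk⟩ := (LieModule.isNilpotent_iff ℂ 𝔫 (Fin n → ℂ)).1 hN
  refine ⟨k, le_bot_iff.1 ?_⟩
  have hle : ∀ k, actionSeries L k ≤
      (LieModule.lowerCentralSeries ℂ 𝔫 (Fin n → ℂ) k).toSubmodule := by
    intro k
    induction k with
    | zero => simp
    | succ k ih =>
      rw [actionSeries_succ_le_iff]
      intro X hX w hw
      rw [LieModule.lowerCentralSeries_succ]
      exact LieSubmodule.lie_mem_lie
        (x := (⟨toLinAlgEquiv' X, X, hX, rfl⟩ : 𝔫)) (LieSubmodule.mem_top _) (ih hw)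
  refine (hle k).trans ?_
  rw [hk]
  exact le_rfl

end Unipotent

/-! ### The unipotent normal subgroup attached to the trace radical -/

section Unipotent

open Matrix

variable {n : ℕ}

theorem mulVec_mem_actionSeries_of_conj {L : Submodule ℂ (Matrix (Fin n) (Fin n) ℂ)}
    {g : GL (Fin n) ℂ}
    (hg : ∀ X ∈ L, (g : Matrix (Fin n) (Fin n) ℂ) * X * (g⁻¹ : GL (Fin n) ℂ) ∈ L) :
    ∀ {k : ℕ} {w : Fin n → ℂ}, w ∈ actionSeries L k →
      (g : Matrix (Fin n) (Fin n) ℂ) *ᵥ w ∈ actionSeries L k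
  | 0, _, _ => Submodule.mem_top
  | k + 1, w, hw => by
    have h : actionSeries L (k + 1) ≤
        (actionSeries L (k + 1)).comap (mulVecLin (g : Matrix (Fin n) (Fin n) ℂ)) := by
      rw [actionSeries_succ_le_iff]
      intro X hX w hw
      have h1 : (g : Matrix (Fin n) (Fin n) ℂ) *ᵥ (X *ᵥ w) =
          ((g : Matrix (Fin n) (Fin n) ℂ) * X * (g⁻¹ : GL (Fin n) ℂ).1) *ᵥ
            ((g : Matrix (Fin n) (Fin n) ℂ) *ᵥ w) := by
        rw [mulVec_mulVec, mulVec_mulVec, mul_assoc, Units.inv_mul, mul_one]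
      change (g : Matrix (Fin n) (Fin n) ℂ) *ᵥ (X *ᵥ w) ∈ actionSeries L (k + 1)
      rw [h1]
      exact mulVec_mem_actionSeries (hg X hX) (mulVec_mem_actionSeries_of_conj hg hw)
    exact h hw

/-- Invertible matrices congruent to the identity along the chain `actionSeries L`. -/
def congruenceSubgroup (L : Submodule ℂ (Matrix (Fin n) (Fin n) ℂ)) : Subgroup (GL (Fin n) ℂ) where
  carrier := {u | ∀ k, ∀ w ∈ actionSeries L k,
    (u : Matrix (Fin n) (Fin n) ℂ) *ᵥ w - w ∈ actionSeries L (k + 1)}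
  one_mem' k w hw := by simp
  mul_mem' := by
    intro u v hu hv k w hw
    have h1 := hv k w hw
    have h2 := actionSeries_succ_le L _ (hu _ _ h1)
    have h3 := hu k w hw
    have h4 := add_mem (add_mem h2 h1) h3
    convert! h4 using 1
    rw [Units.val_mul, ← mulVec_mulVec, mulVec_sub]
    abel
  inv_mem' := by
    intro u hu k w hw
    let f := (mulVecLin (u : Matrix (Fin n) (Fin n) ℂ))
    have hf : ∀ k, ∀ w ∈ actionSeries L k, f w ∈ actionSeries L k := fun k w hw => by
      have := add_mem (actionSeries_succ_le L _ (hu k w hw)) hw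
      rwa [sub_add_cancel] at this
    have hinv : ∀ w, (u⁻¹ : GL (Fin n) ℂ).1 *ᵥ f w = w := fun w => by
      change _ *ᵥ (u.1 *ᵥ w) = w
      rw [mulVec_mulVec, Units.inv_mul, one_mulVec]
    -- An injective endomorphism of a finite-dimensional space is onto, so the inverse also
    -- preserves each term of the chain.
    have hsurj : ∀ k, ∀ w ∈ actionSeries L k, ∃ w' ∈ actionSeries L k, f w' = w := by
      intro k w hw
      have hinj : Function.Injective (f.restrict (hf k)) := by
        intro a b hab
        have h1 : f a.1 = f b.1 := congrArg Subtype.val hab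
        have h2 := congrArg ((u⁻¹ : GL (Fin n) ℂ).1 *ᵥ ·) h1
        simp only [hinv] at h2
        exact Subtype.ext h2
      obtain ⟨w', hw'⟩ := LinearMap.injective_iff_surjective.1 hinj ⟨w, hw⟩
      exact ⟨w', w'.2, congrArg Subtype.val hw'⟩
    have hpres : ∀ k, ∀ w ∈ actionSeries L k, (u⁻¹ : GL (Fin n) ℂ).1 *ᵥ w ∈ actionSeries L k := by
      intro k w hw
      obtain ⟨w', hw', rfl⟩ := hsurj k w hw
      rwa [hinv]
    have h1 := hpres _ _ (neg_mem (hu k w hw))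
    rw [mulVec_neg, mulVec_sub, neg_sub] at h1
    have h2 := hinv w
    change _ *ᵥ (u.1 *ᵥ w) = w at h2
    rwa [h2] at h1

/-- The congruences amount to equations `φ(u w - w) = 0`, with `φ` annihilating the next term of the
chain; these are affine in the entries of `u`. -/
theorem IsZariskiClosed.inf_congruenceSubgroup {H : Subgroup (GL (Fin n) ℂ)}
    (hH : IsZariskiClosed H) (L : Submodule ℂ (Matrix (Fin n) (Fin n) ℂ)) :
    IsZariskiClosed (H ⊓ congruenceSubgroup L) := by
  obtain ⟨S, hS⟩ := hH
  let P : (Fin n → ℂ) → Module.Dual ℂ (Fin n → ℂ) → MvPolynomial (Fin n × Fin n) ℂ := fun w φ =>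
    ∑ i, (∑ j, MvPolynomial.X (i, j) * MvPolynomial.C (w j)) *
      MvPolynomial.C (φ (Pi.single i 1)) - MvPolynomial.C (φ w)
  have hP : ∀ (u : Matrix (Fin n) (Fin n) ℂ) w φ,
      MvPolynomial.eval (fun ij => u ij.1 ij.2) (P w φ) = φ (u *ᵥ w - w) := by
    intro u w φ
    have h1 : φ (u *ᵥ w) = ∑ i, (u *ᵥ w) i * φ (Pi.single i 1) := by
      conv_lhs => rw [← LinearMap.sum_single_apply (φ := fun _ => ℂ) (u *ᵥ w)]
      rw [map_sum]
      refine Finset.sum_congr rfl fun i _ => ?_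
      rw [← smul_eq_mul, ← map_smul]
      congr 1
      ext j
      simp [Pi.single_apply]
    rw [map_sub φ, h1]
    simp [P, mulVec, dotProduct]
  refine ⟨S ∪ {p | ∃ k, ∃ w ∈ actionSeries L k, ∃ φ ∈ (actionSeries L (k + 1)).dualAnnihilator,
    p = P w φ}, fun g => ?_⟩
  rw [Subgroup.mem_inf, hS]
  constructor
  · rintro ⟨h1, h2⟩ p (hp | ⟨k, w, hw, φ, hφ, rfl⟩)
    · exact h1 p hp
    · rw [hP]
      exact (Submodule.mem_dualAnnihilator φ).1 hφ _ (h2 k w hw)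
  · intro h
    refine ⟨fun p hp => h p (Or.inl hp), fun k w hw => ?_⟩
    rw [← Subspace.forall_mem_dualAnnihilator_apply_eq_zero_iff]
    intro φ hφ
    rw [← hP]
    exact h _ (Or.inr ⟨k, w, hw, φ, hφ, rfl⟩)

theorem isNilpotent_sub_one_of_mem_congruenceSubgroup
    {L : Submodule ℂ (Matrix (Fin n) (Fin n) ℂ)} {k : ℕ} (hk : actionSeries L k = ⊥)
    {u : GL (Fin n) ℂ} (hu : u ∈ congruenceSubgroup L) :
    IsNilpotent ((u : Matrix (Fin n) (Fin n) ℂ) - 1) := by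
  refine ⟨k, ?_⟩
  have h : ∀ k w, ((u : Matrix (Fin n) (Fin n) ℂ) - 1) ^ k *ᵥ w ∈ actionSeries L k := by
    intro k
    induction k with
    | zero => exact fun w => Submodule.mem_top
    | succ k ih =>
      intro w
      have := hu k _ (ih w)
      rwa [pow_succ', ← mulVec_mulVec, sub_mulVec, one_mulVec]
  rw [← mulVec_injective.eq_iff]
  funext w
  have := h k w
  rw [hk, Submodule.mem_bot] at this
  rw [this, zero_mulVec]

theorem conj_mem_congruenceSubgroup {L : Submodule ℂ (Matrix (Fin n) (Fin n) ℂ)}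
    {g u : GL (Fin n) ℂ}
    (hg : ∀ X ∈ L, (g : Matrix (Fin n) (Fin n) ℂ) * X * (g⁻¹ : GL (Fin n) ℂ) ∈ L)
    (hg' : ∀ X ∈ L, ((g⁻¹ : GL (Fin n) ℂ) : Matrix (Fin n) (Fin n) ℂ) * X * g ∈ L)
    (hu : u ∈ congruenceSubgroup L) : g * u * g⁻¹ ∈ congruenceSubgroup L := by
  intro k w hw
  have h1 := mulVec_mem_actionSeries_of_conj (g := g⁻¹) (by simpa using hg') hw
  have h2 := mulVec_mem_actionSeries_of_conj hg (hu k _ h1)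
  rw [mulVec_sub, mulVec_mulVec, mulVec_mulVec, mulVec_mulVec, Units.mul_inv, one_mulVec] at h2
  simpa [mul_assoc] using h2

theorem mem_congruenceSubgroup_of_eq_exp {L : Submodule ℂ (Matrix (Fin n) (Fin n) ℂ)}
    {X : Matrix (Fin n) (Fin n) ℂ} (hX : X ∈ L) (hnil : IsNilpotent X) {u : GL (Fin n) ℂ}
    (hu : (u : Matrix (Fin n) (Fin n) ℂ) = NormedSpace.exp X) : u ∈ congruenceSubgroup L := by
  intro k w hw
  obtain ⟨K, hK⟩ := hnil
  -- The exponent `K + 1` guarantees a zeroth term to split off; all remaining terms contain a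
  -- factor `X`.
  have hK1 : X ^ (K + 1) = 0 := by rw [pow_succ, hK, zero_mul]
  have h1 := Matrix.exp_smul_eq_sum hK1 1
  rw [one_smul] at h1
  have hpow : ∀ j, X ^ (j + 1) *ᵥ w ∈ actionSeries L (k + 1) := by
    intro j
    induction j with
    | zero => simpa using mulVec_mem_actionSeries hX hw
    | succ j ih =>
      rw [pow_succ', ← mulVec_mulVec]
      exact actionSeries_succ_le L _ (mulVec_mem_actionSeries hX ih)
  rw [hu, h1, Finset.sum_range_succ']
  simp only [one_pow, mul_one, pow_zero, Nat.factorial_zero, Nat.cast_one, inv_one, one_smul,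
    add_mulVec, one_mulVec, add_sub_cancel_right]
  rw [sum_mulVec]
  refine sum_mem fun j _ => ?_
  rw [smul_mulVec]
  exact Submodule.smul_mem _ _ (hpow j)

attribute [local instance] Matrix.linftyOpNormedRing Matrix.linftyOpNormedAlgebra

theorem hasDerivAt_exp_smul_zero {𝔸 : Type*} [NormedRing 𝔸] [NormedAlgebra ℂ 𝔸] [CompleteSpace 𝔸]
    (X : 𝔸) : HasDerivAt (fun t : ℂ => NormedSpace.exp (t • X)) X 0 := by
  simpa using hasDerivAt_exp_smul_const X (0 : ℂ)

theorem hasDerivAt_exp_neg_smul_zero {𝔸 : Type*} [NormedRing 𝔸] [NormedAlgebra ℂ 𝔸]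
    [CompleteSpace 𝔸] (X : 𝔸) : HasDerivAt (fun t : ℂ => NormedSpace.exp ((-t) • X)) (-X) 0 := by
  simpa using hasDerivAt_exp_smul_zero (-X)

/-- The commutator is the derivative at `t = 0` of the conjugated matrix, so a functional vanishing
on `L` vanishes on it. -/
theorem bracket_mem_of_conj_mem {L : Submodule ℂ (Matrix (Fin n) (Fin n) ℂ)}
    {X Y : Matrix (Fin n) (Fin n) ℂ}
    (h : ∀ t : ℂ, NormedSpace.exp (t • X) * Y * NormedSpace.exp ((-t) • X) ∈ L) :
    X * Y - Y * X ∈ L := by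
  rw [← Subspace.forall_mem_dualAnnihilator_apply_eq_zero_iff]
  intro φ hφ
  have h1 : HasDerivAt (fun t : ℂ => NormedSpace.exp (t • X)) X 0 :=
    hasDerivAt_exp_smul_zero X
  have h2 : HasDerivAt (fun t : ℂ => NormedSpace.exp ((-t) • X)) (-X) 0 :=
    hasDerivAt_exp_neg_smul_zero X
  have h3 := (h1.mul_const Y).mul h2
  have h4 := (LinearMap.toContinuousLinearMap φ).hasFDerivAt.comp_hasDerivAt (0 : ℂ) h3
  have h5 : (LinearMap.toContinuousLinearMap φ) ∘
      ((fun t : ℂ => NormedSpace.exp (t • X) * Y) * fun t => NormedSpace.exp ((-t) • X)) =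
      fun _ => 0 :=
    funext fun t => (Submodule.mem_dualAnnihilator φ).1 hφ _ (h t)
  rw [h5] at h4
  have h6 := h4.unique (hasDerivAt_const (0 : ℂ) (0 : ℂ))
  have h7 : φ (X * Y * NormedSpace.exp (-(0 : ℂ) • X) +
      NormedSpace.exp ((0 : ℂ) • X) * Y * -X) = 0 := h6
  simpa [sub_eq_add_neg] using h7

/-- In a reductive group, the trace form is nondegenerate on the space of generators of
one-parameter subgroups. -/
theorem IsReductiveLinearGroup.eq_zero_of_trace_eq_zero {H : Subgroup (GL (Fin n) ℂ)}
    (hH : IsReductiveLinearGroup H) (V : Submodule ℂ (Matrix (Fin n) (Fin n) ℂ))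
    (hV : ∀ X, X ∈ V ↔ IsOneParameterGenerator H X) {X : Matrix (Fin n) (Fin n) ℂ} (hX : X ∈ V)
    (htr : ∀ Y ∈ V, trace (X * Y) = 0) : X = 0 := by
  let L : Submodule ℂ (Matrix (Fin n) (Fin n) ℂ) :=
    { carrier := {X | X ∈ V ∧ ∀ Y ∈ V, trace (X * Y) = 0}
      zero_mem' := ⟨zero_mem _, by simp⟩
      add_mem' := fun hX hY => ⟨add_mem hX.1 hY.1, fun Z hZ => by
        rw [add_mul, trace_add, hX.2 Z hZ, hY.2 Z hZ, add_zero]⟩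
      smul_mem' := fun c X hX => ⟨V.smul_mem c hX.1, fun Z hZ => by
        rw [smul_mul_assoc, trace_smul, hX.2 Z hZ, smul_zero]⟩ }
  have hVconj : ∀ g ∈ H, ∀ Y ∈ V, (g : Matrix (Fin n) (Fin n) ℂ) * Y * (g⁻¹ : GL (Fin n) ℂ) ∈ V := by
    intro g hg Y hY
    rw [hV] at hY ⊢
    intro t
    obtain ⟨u, hu, hut⟩ := hY t
    refine ⟨g * u * g⁻¹, mul_mem (mul_mem hg hu) (inv_mem hg), ?_⟩
    rw [Units.val_mul, Units.val_mul, hut, ← smul_mul_assoc, ← mul_smul_comm,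
      Matrix.exp_units_conj]
  have hLconj : ∀ g ∈ H, ∀ Y ∈ L, (g : Matrix (Fin n) (Fin n) ℂ) * Y * (g⁻¹ : GL (Fin n) ℂ) ∈ L := by
    rintro g hg Y ⟨hY, hYtr⟩
    refine ⟨hVconj g hg Y hY, fun Z hZ => ?_⟩
    have h1 := hYtr _ (hVconj g⁻¹ (inv_mem hg) Z hZ)
    rw [inv_inv] at h1
    rw [← h1, mul_assoc, mul_assoc, trace_mul_comm]
    simp only [mul_assoc]
  have hnil : ∀ Y ∈ L, IsNilpotent Y := fun Y hY =>
    hH.isZariskiClosed.isNilpotent_of_trace_eq_zero ((hV Y).1 hY.1)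
      fun Z hZ => hY.2 Z ((hV Z).2 hZ)
  have hbr : ∀ Y ∈ L, ∀ Z ∈ L, Y * Z - Z * Y ∈ L := by
    intro Y hY Z hZ
    refine bracket_mem_of_conj_mem fun t => ?_
    obtain ⟨g, hg, hgt⟩ := (hV Y).1 hY.1 t
    have h1 := hLconj g hg Z hZ
    rwa [coe_units_inv, hgt, ← Matrix.exp_neg, ← neg_smul] at h1
  obtain ⟨k, hk⟩ := exists_actionSeries_eq_bot L hbr hnil
  -- Reductivity enters here. Normality holds for all of `H`, connected or not, because conjugation
  -- by `H` preserves the trace form and hence its radical `L`.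
  have hU : H ⊓ congruenceSubgroup L = ⊥ := by
    refine hH.eq_bot_of_unipotent _ inf_le_left (hH.isZariskiClosed.inf_congruenceSubgroup L)
      (fun h hh u hu => ⟨mul_mem (mul_mem hh hu.1) (H.inv_mem hh),
        conj_mem_congruenceSubgroup (hLconj h hh) ?_ hu.2⟩)
      fun u hu => isNilpotent_sub_one_of_mem_congruenceSubgroup hk hu.2
    simpa using hLconj h⁻¹ (H.inv_mem hh)
  have hexp : ∀ t : ℂ, NormedSpace.exp (t • X) = 1 := by
    intro t
    obtain ⟨g, hg, hgt⟩ := (hV X).1 hX t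
    have hXL : t • X ∈ L := L.smul_mem t ⟨hX, htr⟩
    have h1 : g ∈ H ⊓ congruenceSubgroup L :=
      ⟨hg, mem_congruenceSubgroup_of_eq_exp hXL (hnil _ hXL) hgt⟩
    rw [hU, Subgroup.mem_bot] at h1
    rw [← hgt, h1, Units.val_one]
  have h1 : HasDerivAt (fun t : ℂ => NormedSpace.exp (t • X)) X 0 :=
    hasDerivAt_exp_smul_zero X
  rw [funext hexp] at h1
  exact h1.unique (hasDerivAt_const _ _)

end Unipotent

/-! ### Exponentials as limits of powers -/

section ExpLimit

open Filter Topology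

variable {𝔸 : Type*} [NormedRing 𝔸]

theorem norm_mul_le_of_norm_sub_one_le {b : 𝔸} {r : ℝ} (hb : ‖b - 1‖ ≤ r) (x : 𝔸) :
    ‖x * b‖ ≤ ‖x‖ * (1 + r) := by
  have h : x * b = x + x * (b - 1) := by noncomm_ring
  calc ‖x * b‖ = ‖x + x * (b - 1)‖ := by rw [h]
    _ ≤ ‖x‖ + ‖x‖ * ‖b - 1‖ := (norm_add_le _ _).trans (by gcongr; exact norm_mul_le _ _)
    _ ≤ ‖x‖ + ‖x‖ * r := by gcongr
    _ = ‖x‖ * (1 + r) := by ring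

theorem norm_pow_le_of_norm_sub_one_le {a : 𝔸} {r : ℝ} (ha : ‖a - 1‖ ≤ r) (m : ℕ) :
    ‖a ^ m‖ ≤ ‖(1 : 𝔸)‖ * (1 + r) ^ m := by
  have hr : 0 ≤ r := (norm_nonneg _).trans ha
  induction m with
  | zero => simp
  | succ m ih =>
    rw [pow_succ, pow_succ, ← mul_assoc]
    exact (norm_mul_le_of_norm_sub_one_le ha _).trans (by gcongr)

/-- Telescoping one factor at a time. The factor `‖1‖` stays because the norm of the unit is not
assumed to be one. -/
theorem norm_pow_sub_pow_le_of_norm_sub_one_le {a b : 𝔸} {r : ℝ} (ha : ‖a - 1‖ ≤ r)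
    (hb : ‖b - 1‖ ≤ r) (m : ℕ) :
    ‖a ^ m - b ^ m‖ ≤ ‖(1 : 𝔸)‖ * (m * (1 + r) ^ m) * ‖a - b‖ := by
  have hr : 0 ≤ r := (norm_nonneg _).trans ha
  induction m with
  | zero => simp
  | succ m ih =>
    have h : a ^ (m + 1) - b ^ (m + 1) = a ^ m * (a - b) + (a ^ m - b ^ m) * b := by
      rw [pow_succ, pow_succ]
      noncomm_ring
    have h1 : ‖a ^ m * (a - b)‖ ≤ ‖(1 : 𝔸)‖ * (1 + r) ^ m * ‖a - b‖ :=
      (norm_mul_le _ _).trans (by gcongr; exact norm_pow_le_of_norm_sub_one_le ha m)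
    have h2 : ‖(a ^ m - b ^ m) * b‖ ≤ ‖(1 : 𝔸)‖ * (m * (1 + r) ^ m) * ‖a - b‖ * (1 + r) :=
      (norm_mul_le_of_norm_sub_one_le hb _).trans (by gcongr)
    have h3 : (1 + r) ^ m ≤ (1 + r) ^ (m + 1) := pow_le_pow_right₀ (by linarith) (Nat.le_succ m)
    calc ‖a ^ (m + 1) - b ^ (m + 1)‖
        ≤ ‖(1 : 𝔸)‖ * (1 + r) ^ m * ‖a - b‖ + ‖(1 : 𝔸)‖ * (m * (1 + r) ^ m) * ‖a - b‖ * (1 + r) := by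
          rw [h]
          exact (norm_add_le _ _).trans (add_le_add h1 h2)
      _ ≤ ‖(1 : 𝔸)‖ * (1 + r) ^ (m + 1) * ‖a - b‖ +
          ‖(1 : 𝔸)‖ * (m * (1 + r) ^ m) * ‖a - b‖ * (1 + r) := by gcongr
      _ = _ := by push_cast; ring

variable [NormedAlgebra ℂ 𝔸]

theorem tendsto_nat_smul_exp_sub_one [CompleteSpace 𝔸] (X : 𝔸) :
    Tendsto (fun k : ℕ => ((k : ℂ) + 1) • (NormedSpace.exp (((k : ℂ) + 1)⁻¹ • X) - 1)) atTop
      (𝓝 X) := by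
  have h := (hasDerivAt_iff_tendsto_slope_zero.1 (hasDerivAt_exp_smul_zero X))
  simp only [zero_add, zero_smul, NormedSpace.exp_zero] at h
  have h2 : Tendsto (fun k : ℕ => ((k : ℂ) + 1)⁻¹) atTop (𝓝[≠] 0) := by
    refine tendsto_nhdsWithin_iff.2 ⟨?_, Eventually.of_forall fun k => ?_⟩
    · simpa using tendsto_one_div_add_atTop_nhds_zero_nat (𝕜 := ℂ)
    · exact inv_ne_zero (Nat.cast_add_one_ne_zero k)
  simpa [Function.comp_def] using h.comp h2

/-- If `k (a_k - 1) → X` then `a_k ^ k → exp X`. -/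
theorem tendsto_pow_exp_of_tendsto [CompleteSpace 𝔸] {a : ℕ → 𝔸} {X : 𝔸}
    (ha : Tendsto (fun k : ℕ => ((k : ℂ) + 1) • (a k - 1)) atTop (𝓝 X)) :
    Tendsto (fun k => a k ^ (k + 1)) atTop (𝓝 (NormedSpace.exp X)) := by
  -- The comparison sequence, with `(k + 1)`-st power exactly `exp X`. Both `a k` and `b k` are
  -- within `C / (k + 1)` of `1`, so the powers differ by at most a constant times `(k + 1) ‖a k - b
  -- k‖`, which tends to zero.
  let b : ℕ → 𝔸 := fun k => NormedSpace.exp (((k : ℂ) + 1)⁻¹ • X)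
  have hb : Tendsto (fun k : ℕ => ((k : ℂ) + 1) • (b k - 1)) atTop (𝓝 X) :=
    tendsto_nat_smul_exp_sub_one X
  have hbpow : ∀ k, b k ^ (k + 1) = NormedSpace.exp X := by
    intro k
    let _ : NormedAlgebra ℚ 𝔸 := NormedAlgebra.restrictScalars ℚ ℂ 𝔸
    rw [← NormedSpace.exp_nsmul, ← Nat.cast_smul_eq_nsmul ℂ, smul_smul, Nat.cast_add_one,
      mul_inv_cancel₀ (Nat.cast_add_one_ne_zero k), one_smul]
  let C : ℝ := ‖X‖ + 1
  have hC : 0 ≤ C := by positivity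
  have hbound : ∀ c : ℕ → 𝔸, Tendsto (fun k : ℕ => ((k : ℂ) + 1) • (c k - 1)) atTop (𝓝 X) →
      ∀ᶠ k : ℕ in atTop, ‖c k - 1‖ ≤ C / (k + 1) := by
    intro c hc
    filter_upwards [hc.norm.eventually_le_const (lt_add_one ‖X‖)] with k hk
    rw [norm_smul] at hk
    have h1 : ‖(k : ℂ) + 1‖ = (k : ℝ) + 1 := by
      rw [← Nat.cast_add_one, Complex.norm_natCast, Nat.cast_add_one]
    rw [h1] at hk
    rw [le_div_iff₀ (by positivity), mul_comm]
    exact hk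
  have hdiff : Tendsto (fun k : ℕ => ‖((k : ℂ) + 1) • (a k - b k)‖) atTop (𝓝 0) := by
    have := (ha.sub hb).norm
    simpa [← smul_sub] using this
  rw [tendsto_iff_norm_sub_tendsto_zero]
  have hlim : Tendsto (fun k : ℕ => ‖(1 : 𝔸)‖ * Real.exp C * ‖((k : ℂ) + 1) • (a k - b k)‖) atTop
      (𝓝 0) := by
    simpa using hdiff.const_mul (‖(1 : 𝔸)‖ * Real.exp C)
  refine squeeze_zero' (Eventually.of_forall fun _ => norm_nonneg _) ?_ hlim
  filter_upwards [hbound a ha, hbound b hb] with k hka hkb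
  rw [← hbpow k]
  refine (norm_pow_sub_pow_le_of_norm_sub_one_le hka hkb (k + 1)).trans ?_
  have h1 : ‖(k : ℂ) + 1‖ = (k : ℝ) + 1 := by
    rw [← Nat.cast_add_one, Complex.norm_natCast, Nat.cast_add_one]
  have h2 : (1 + C / ((k : ℝ) + 1)) ^ (k + 1) ≤ Real.exp C := by
    have h3 := Real.add_one_le_exp (C / ((k : ℝ) + 1))
    calc (1 + C / ((k : ℝ) + 1)) ^ (k + 1) ≤ (Real.exp (C / ((k : ℝ) + 1))) ^ (k + 1) := by
          refine pow_le_pow_left₀ (by positivity) ?_ _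
          linarith
      _ = Real.exp C := by
          rw [← Real.exp_nat_mul]
          congr 1
          push_cast
          field_simp
  rw [norm_smul, h1]
  push_cast
  calc ‖(1 : 𝔸)‖ * (((k : ℝ) + 1) * (1 + C / ((k : ℝ) + 1)) ^ (k + 1)) * ‖a k - b k‖
      ≤ ‖(1 : 𝔸)‖ * (((k : ℝ) + 1) * Real.exp C) * ‖a k - b k‖ := by gcongr
    _ = _ := by ring

end ExpLimit

/-! ### The image of the differential and one-parameter subgroups -/

noncomputable section Differential

open Filter Topology Matrix

variable {E : Type*} [NormedAddCommGroup E] [NormedSpace ℂ E]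
  {G : Type*} [TopologicalSpace G] [ChartedSpace E G] [Group G] {n : ℕ}

/-- The differential at the identity of a matrix representation of a complex Lie group. -/
def matrixDifferential (ρ : G →* GL (Fin n) ℂ) :
    GroupLieAlgebra 𝓘(ℂ, E) G →ₗ[ℂ] Matrix (Fin n) (Fin n) ℂ where
  toFun v := Matrix.of fun i j =>
    mfderiv 𝓘(ℂ, E) 𝓘(ℂ, ℂ) (fun g : G => (ρ g : Matrix (Fin n) (Fin n) ℂ) i j) 1 v
  map_add' v w := by
    ext i j
    exact (mfderiv 𝓘(ℂ, E) 𝓘(ℂ, ℂ)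
      (fun g : G => (ρ g : Matrix (Fin n) (Fin n) ℂ) i j) 1).map_add v w
  map_smul' c v := by
    ext i j
    exact (mfderiv 𝓘(ℂ, E) 𝓘(ℂ, ℂ)
      (fun g : G => (ρ g : Matrix (Fin n) (Fin n) ℂ) i j) 1).map_smul c v

variable {ρ : G →* GL (Fin n) ℂ}

theorem hasMFDerivAt_entry
    (hρ : ∀ i j, ContMDiff 𝓘(ℂ, E) 𝓘(ℂ, ℂ) ω (fun g : G => (ρ g : Matrix (Fin n) (Fin n) ℂ) i j))
    (i j : Fin n) : HasMFDerivAt 𝓘(ℂ, E) 𝓘(ℂ, ℂ)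
      (fun g : G => (ρ g : Matrix (Fin n) (Fin n) ℂ) i j) 1
      (mfderiv 𝓘(ℂ, E) 𝓘(ℂ, ℂ) (fun g : G => (ρ g : Matrix (Fin n) (Fin n) ℂ) i j) 1) :=
  ((hρ i j 1).mdifferentiableAt (by simp)).hasMFDerivAt

/-- In the preferred chart at the identity, a matrix representation is differentiable. -/
theorem exists_hasFDerivAt_chart
    (hρ : ∀ i j, ContMDiff 𝓘(ℂ, E) 𝓘(ℂ, ℂ) ω (fun g : G => (ρ g : Matrix (Fin n) (Fin n) ℂ) i j)) :
    ∃ D : E →L[ℂ] Matrix (Fin n) (Fin n) ℂ, (∀ v : E, D v = matrixDifferential (E := E) ρ v) ∧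
      HasFDerivAt (fun e => (ρ ((chartAt E (1 : G)).symm e) : Matrix (Fin n) (Fin n) ℂ)) D
        (chartAt E (1 : G) 1) := by
  let D' : Fin n → Fin n → E →L[ℂ] ℂ := fun i j =>
    mfderiv 𝓘(ℂ, E) 𝓘(ℂ, ℂ) (fun g : G => (ρ g : Matrix (Fin n) (Fin n) ℂ) i j) 1
  let D : E →L[ℂ] (Fin n → Fin n → ℂ) :=
    ContinuousLinearMap.pi fun i => ContinuousLinearMap.pi fun j => D' i j
  have hD : HasFDerivAt (fun (e : E) (i j : Fin n) =>
      (ρ ((chartAt E (1 : G)).symm e) : Matrix (Fin n) (Fin n) ℂ) i j) D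
      (chartAt E (1 : G) 1) := by
    refine hasFDerivAt_pi.2 fun i => hasFDerivAt_pi.2 fun j => ?_
    have h := (hasMFDerivAt_entry hρ i j).2
    rw [ModelWithCorners.range_eq_univ] at h
    have h' : HasFDerivWithinAt (fun e : E =>
      (ρ ((chartAt E (1 : G)).symm e) : Matrix (Fin n) (Fin n) ℂ) i j) (D' i j) Set.univ
      (chartAt E (1 : G) 1) := h
    exact hasFDerivWithinAt_univ.1 h'
  exact ⟨D, fun v => rfl, hD⟩

/-- The differential of a matrix representation intertwines the adjoint representation with
conjugation. -/
theorem matrixDifferential_adLinear [LieGroup 𝓘(ℂ, E) ω G]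
    (hρ : ∀ i j, ContMDiff 𝓘(ℂ, E) 𝓘(ℂ, ℂ) ω (fun g : G => (ρ g : Matrix (Fin n) (Fin n) ℂ) i j))
    (g : G) (v : GroupLieAlgebra 𝓘(ℂ, E) G) :
    matrixDifferential ρ (adLinear E G g v) =
      (ρ g : Matrix (Fin n) (Fin n) ℂ) * matrixDifferential ρ v * (ρ g⁻¹ : GL (Fin n) ℂ) := by
  have hc : MDifferentiableAt 𝓘(ℂ, E) 𝓘(ℂ, E) (fun x : G => g * x * g⁻¹) 1 := by
    have hc : ContMDiff 𝓘(ℂ, E) 𝓘(ℂ, E) ω (fun x : G => g * x * g⁻¹) :=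
      (contMDiff_mul_right (a := g⁻¹)).comp (contMDiff_mul_left (a := g))
    exact (hc 1).mdifferentiableAt (by simp)
  ext i j
  let f : Fin n → Fin n → G → ℂ := fun i j x => (ρ x : Matrix (Fin n) (Fin n) ℂ) i j
  let f' : Fin n → Fin n → E →L[ℂ] ℂ := fun i j => mfderiv 𝓘(ℂ, E) 𝓘(ℂ, ℂ) (f i j) 1
  have hf : ∀ y : G, y = 1 → HasMFDerivAt 𝓘(ℂ, E) 𝓘(ℂ, ℂ) (f i j) y (f' i j) := by
    rintro y rfl
    exact hasMFDerivAt_entry hρ i j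
  have h1 := HasMFDerivAt.comp (1 : G) (hf (g * 1 * g⁻¹) (by simp)) hc.hasMFDerivAt
  -- Entries of `ρ (g x g⁻¹)` are linear combinations of entries of `ρ x` with coefficients
  -- independent of `x`.
  have h2 : HasMFDerivAt 𝓘(ℂ, E) 𝓘(ℂ, ℂ)
      (∑ k, ∑ l, (f i k g * f l j g⁻¹) • f k l) (1 : G)
      (∑ k, ∑ l, (f i k g * f l j g⁻¹) • f' k l) :=
    HasMFDerivAt.sum fun k _ => HasMFDerivAt.sum fun l _ =>
      (hasMFDerivAt_entry hρ k l).const_smul _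
  have h3 : f i j ∘ (fun x : G => g * x * g⁻¹) = ∑ k, ∑ l, (f i k g * f l j g⁻¹) • f k l := by
    ext x
    simp only [f, Function.comp_apply, map_mul, Units.val_mul, mul_apply, Finset.sum_apply,
      Pi.smul_apply, smul_eq_mul, Finset.sum_mul]
    rw [Finset.sum_comm]
    exact Finset.sum_congr rfl fun k _ => Finset.sum_congr rfl fun l _ => by ring
  rw [h3] at h1
  have h4 := hasMFDerivAt_unique h1 h2
  have h5 := DFunLike.congr_fun h4 v
  refine Eq.trans h5 ?_
  have h6 : ∀ w : E, (∑ k, ∑ l, (f i k g * f l j g⁻¹) • f' k l) w =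
      ∑ k, ∑ l, f i k g * f l j g⁻¹ * f' k l w := fun w => by simp
  have h7 : ∀ k l, matrixDifferential ρ v k l = f' k l v := fun k l => rfl
  refine (h6 v).trans ?_
  simp only [mul_apply, Finset.sum_mul, h7]
  rw [Finset.sum_comm]
  refine Finset.sum_congr rfl fun l _ => Finset.sum_congr rfl fun k _ => ?_
  simp only [f]
  ring

attribute [local instance] Matrix.linftyOpNormedRing Matrix.linftyOpNormedAlgebra

theorem tendsto_exp_smul_zero {𝔸 : Type*} [NormedRing 𝔸] [NormedAlgebra ℂ 𝔸] [CompleteSpace 𝔸]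
    (X : 𝔸) : Tendsto (fun t : ℂ => NormedSpace.exp (t • X)) (𝓝 0) (𝓝 1) := by
  simpa using (hasDerivAt_exp_smul_zero X).continuousAt.tendsto

theorem Matrix.tendsto_pow_exp_of_tendsto {a : ℕ → Matrix (Fin n) (Fin n) ℂ}
    {X : Matrix (Fin n) (Fin n) ℂ}
    (ha : Tendsto (fun k : ℕ => ((k : ℂ) + 1) • (a k - 1)) atTop (𝓝 X)) :
    Tendsto (fun k => a k ^ (k + 1)) atTop (𝓝 (NormedSpace.exp X)) :=
  _root_.tendsto_pow_exp_of_tendsto ha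

theorem Matrix.tendsto_nat_smul_exp_sub_one (X : Matrix (Fin n) (Fin n) ℂ) :
    Tendsto (fun k : ℕ => ((k : ℂ) + 1) • (NormedSpace.exp (((k : ℂ) + 1)⁻¹ • X) - 1)) atTop
      (𝓝 X) :=
  _root_.tendsto_nat_smul_exp_sub_one X

theorem Matrix.GeneralLinearGroup.tendsto_iff {α : Type*} {l : Filter α} {f : α → GL (Fin n) ℂ}
    {g : GL (Fin n) ℂ} : Tendsto f l (𝓝 g) ↔
      Tendsto (fun x => (f x : Matrix (Fin n) (Fin n) ℂ)) l (𝓝 (g : Matrix (Fin n) (Fin n) ℂ)) :=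
  (Units.isOpenEmbedding_val (R := Matrix (Fin n) (Fin n) ℂ)).tendsto_nhds_iff

theorem Matrix.tendsto_exp_inv_smul (X : Matrix (Fin n) (Fin n) ℂ) :
    Tendsto (fun k : ℕ => NormedSpace.exp (((k : ℂ) + 1)⁻¹ • X)) atTop (𝓝 1) := by
  have h : Tendsto (fun t : ℂ => NormedSpace.exp (t • X)) (𝓝 0) (𝓝 1) :=
    tendsto_exp_smul_zero X
  have h2 : Tendsto (fun k : ℕ => ((k : ℂ) + 1)⁻¹) atTop (𝓝 0) := by
    simpa using tendsto_one_div_add_atTop_nhds_zero_nat (𝕜 := ℂ)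
  exact h.comp h2

/-- Limits in `GL_n` of elements of a Zariski closed subgroup belong to it. -/
theorem IsZariskiClosed.mem_of_tendsto {H : Subgroup (GL (Fin n) ℂ)} (hH : IsZariskiClosed H)
    {a : ℕ → GL (Fin n) ℂ} (ha : ∀ k, a k ∈ H) {u : GL (Fin n) ℂ}
    (hlim : Tendsto (fun k => (a k : Matrix (Fin n) (Fin n) ℂ)) atTop (𝓝 u)) : u ∈ H := by
  obtain ⟨S, hS⟩ := hH
  rw [hS]
  intro p hp
  have hcont : Continuous fun M : Matrix (Fin n) (Fin n) ℂ =>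
      MvPolynomial.eval (fun ij : Fin n × Fin n => M ij.1 ij.2) p :=
    (MvPolynomial.continuous_eval p).comp
      (continuous_pi fun ij => continuous_id.matrix_elem ij.1 ij.2)
  refine tendsto_nhds_unique ((hcont.tendsto _).comp hlim) ?_
  refine tendsto_const_nhds.congr fun k => ?_
  exact ((hS (a k)).1 (ha k) p hp).symm

/-- Elements of the image of the differential generate one-parameter groups in the image. -/
theorem isOneParameterGenerator_matrixDifferential
    (hρ : ∀ i j, ContMDiff 𝓘(ℂ, E) 𝓘(ℂ, ℂ) ω (fun g : G => (ρ g : Matrix (Fin n) (Fin n) ℂ) i j))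
    (hclosed : IsZariskiClosed ρ.range) (v : GroupLieAlgebra 𝓘(ℂ, E) G) :
    IsOneParameterGenerator ρ.range (matrixDifferential ρ v) := by
  suffices h : ∀ v : GroupLieAlgebra 𝓘(ℂ, E) G, ∃ g ∈ ρ.range,
      (g : Matrix (Fin n) (Fin n) ℂ) = NormedSpace.exp (matrixDifferential ρ v) by
    intro t
    rw [← map_smul]
    exact h (t • v)
  clear v
  intro v
  obtain ⟨D, hD, hF⟩ := exists_hasFDerivAt_chart hρ
  let w : E := v
  -- Points approaching `1` along a line in the chart with velocity `w`. Thus `(k + 1)(ρ (y k) - 1)`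
  -- tends to the differential, the powers tend to its exponential, and Zariski closedness keeps the
  -- limit in the range.
  let y : ℕ → G := fun k =>
    (chartAt E (1 : G)).symm (chartAt E (1 : G) 1 + ((k : ℂ) + 1)⁻¹ • w)
  have hlim : Tendsto (fun k : ℕ => ((k : ℂ) + 1) • ((ρ (y k) : Matrix (Fin n) (Fin n) ℂ) - 1))
      atTop (𝓝 (matrixDifferential ρ v)) := by
    have hnorm : Tendsto (fun k : ℕ => ‖((k : ℂ) + 1)‖) atTop atTop := by
      have h1 : (fun k : ℕ => ‖((k : ℂ) + 1)‖) = fun k : ℕ => (k : ℝ) + 1 := by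
        funext k
        rw [← Nat.cast_add_one, Complex.norm_natCast, Nat.cast_add_one]
      rw [h1]
      exact tendsto_atTop_add_const_right _ _ tendsto_natCast_atTop_atTop
    have h1 := hF.lim w hnorm
    rw [hD] at h1
    rw [(chartAt E (1 : G)).left_inv (mem_chart_source E 1), map_one, Units.val_one] at h1
    exact h1
  have hpow := Matrix.tendsto_pow_exp_of_tendsto hlim
  obtain ⟨u, hu⟩ := Matrix.isUnit_exp (matrixDifferential ρ v)
  refine ⟨u, ?_, hu⟩
  refine hclosed.mem_of_tendsto (a := fun k => ρ (y k) ^ (k + 1))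
    (fun k => ρ.range.pow_mem ⟨y k, rfl⟩ _) ?_
  rw [hu]
  simpa using hpow

/-- Generators of one-parameter subgroups of the image of an embedded group belong to the image
of the differential. -/
theorem mem_range_matrixDifferential [FiniteDimensional ℂ E]
    (hρ : ∀ i j, ContMDiff 𝓘(ℂ, E) 𝓘(ℂ, ℂ) ω (fun g : G => (ρ g : Matrix (Fin n) (Fin n) ℂ) i j))
    (hemb : IsEmbedding ρ)
    (hinj : Function.Injective (matrixDifferential (E := E) ρ)) {X : Matrix (Fin n) (Fin n) ℂ}
    (hX : IsOneParameterGenerator ρ.range X) :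
    X ∈ LinearMap.range (matrixDifferential (E := E) ρ) := by
  obtain ⟨D, hD, hF⟩ := exists_hasFDerivAt_chart hρ
  have hy : ∀ k : ℕ, ∃ y : G, (ρ y : Matrix (Fin n) (Fin n) ℂ) =
      NormedSpace.exp (((k : ℂ) + 1)⁻¹ • X) := fun k => by
    obtain ⟨_, ⟨y, rfl⟩, h⟩ := hX (((k : ℂ) + 1)⁻¹)
    exact ⟨y, h⟩
  choose y hy using hy
  -- The topological embedding transfers convergence from `GL_n` to `G`, so the points eventually
  -- lie in the chart at `1`.
  have hy1 : Tendsto y atTop (𝓝 1) := by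
    rw [hemb.tendsto_nhds_iff, map_one, Matrix.GeneralLinearGroup.tendsto_iff]
    simp only [Function.comp_apply, hy]
    exact Matrix.tendsto_exp_inv_smul X
  let c := chartAt E (1 : G)
  have hc1 : (1 : G) ∈ c.source := mem_chart_source E 1
  have he : Tendsto (fun k => c (y k)) atTop (𝓝 (c 1)) :=
    (c.continuousAt hc1).tendsto.comp hy1
  have hcy : ∀ᶠ k in atTop, c.symm (c (y k)) = y k := by
    filter_upwards [hy1.eventually (c.open_source.mem_nhds hc1)] with k hk
    exact c.left_inv hk
  have hDinj : Function.Injective D := fun a b hab => by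
    rw [hD, hD] at hab
    exact hinj hab
  obtain ⟨K, hK0, hK⟩ := LinearMap.exists_antilipschitzWith D.toLinearMap
    (LinearMap.ker_eq_bot.2 hDinj)
  let d : ℕ → E := fun k => c (y k) - c 1
  let M : ℕ → Matrix (Fin n) (Fin n) ℂ := fun k => NormedSpace.exp (((k : ℂ) + 1)⁻¹ • X) - 1
  have hR : (fun k => M k - D (d k)) =o[atTop] d := by
    refine (hF.isLittleO.comp_tendsto he).congr' ?_ (Eventually.of_forall fun _ => rfl)
    filter_upwards [hcy] with k hk
    simp only [Function.comp_apply]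
    change (ρ (c.symm (c (y k))) : Matrix (Fin n) (Fin n) ℂ) - ρ (c.symm (c 1)) - D (d k) = _
    rw [hk, hy, c.left_inv hc1, map_one, Units.val_one]
  -- Since `D` is injective it is bounded below, so the Taylor remainder is also negligible against
  -- `M k`. Therefore `D ((k + 1) • d k)` tends to `X`, and the range of `D` is closed.
  have hdD : d =O[atTop] fun k => D (d k) := by
    refine Asymptotics.IsBigO.of_bound K (Eventually.of_forall fun k => ?_)
    have := hK.le_mul_dist (d k) 0
    simpa using this
  have hDM : (fun k => D (d k)) =O[atTop] M := by
    simpa using (hR.trans_isBigO hdD).right_isBigO_add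
  have hRM : (fun k => M k - D (d k)) =o[atTop] M := hR.trans_isBigO (hdD.trans hDM)
  have hM : Tendsto (fun k : ℕ => ((k : ℂ) + 1) • M k) atTop (𝓝 X) :=
    Matrix.tendsto_nat_smul_exp_sub_one X
  have hR0 : Tendsto (fun k : ℕ => ((k : ℂ) + 1) • (M k - D (d k))) atTop (𝓝 0) := by
    have h1 : (fun k : ℕ => ((k : ℂ) + 1) • (M k - D (d k))) =o[atTop]
        fun k : ℕ => ((k : ℂ) + 1) • M k :=
      (Asymptotics.isBigO_refl (fun k : ℕ => ((k : ℂ) + 1)) atTop).smul_isLittleO hRM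
    exact (Asymptotics.isLittleO_one_iff ℝ).1 (h1.trans_isBigO (hM.isBigO_one ℝ))
  have hlim : Tendsto (fun k : ℕ => D (((k : ℂ) + 1) • d k)) atTop (𝓝 X) := by
    have h1 := hM.sub hR0
    rw [sub_zero] at h1
    refine h1.congr fun k => ?_
    rw [map_smul, ← smul_sub, sub_sub_cancel]
  have hclosed : IsClosed (LinearMap.range D.toLinearMap : Set (Matrix (Fin n) (Fin n) ℂ)) :=
    Submodule.closed_of_finiteDimensional _
  obtain ⟨e, he⟩ := hclosed.mem_of_tendsto hlim (Eventually.of_forall fun k => ⟨_, rfl⟩)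
  exact ⟨e, (hD e).symm.trans he⟩

end Differential

/-! ### Orthogonal complements and quotients -/

section Duality

/-- The form carries the orthogonal `K` onto the annihilator of `W`, which is the dual of the
quotient; the dimensions then agree. -/
theorem Submodule.nonempty_quotient_equiv_of_bilinear {k V : Type*} [Field k] [AddCommGroup V]
    [Module k V] [FiniteDimensional k V] (B : V →ₗ[k] V →ₗ[k] k)
    (hB : ∀ w, (∀ v, B v w = 0) → w = 0) (W K : Submodule k V)
    (hK : ∀ w, w ∈ K ↔ ∀ v ∈ W, B v w = 0) : Nonempty ((V ⧸ W) ≃ₗ[k] K) := by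
  have hinj : Function.Injective B.flip := by
    rw [← LinearMap.ker_eq_bot, LinearMap.ker_eq_bot']
    exact fun w hw => hB w fun v => DFunLike.congr_fun hw v
  let e : V ≃ₗ[k] Module.Dual k V :=
    LinearEquiv.ofInjectiveOfFinrankEq B.flip hinj (Subspace.dual_finrank_eq).symm
  have he : K.map e.toLinearMap = W.dualAnnihilator := by
    ext φ
    rw [Submodule.mem_dualAnnihilator]
    constructor
    · rintro ⟨w, hw, rfl⟩
      exact (hK w).1 hw
    · intro h
      refine ⟨e.symm φ, (hK _).2 fun v hv => ?_, e.apply_symm_apply φ⟩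
      have h1 : B v (e.symm φ) = e (e.symm φ) v := rfl
      rw [h1, e.apply_symm_apply]
      exact h v hv
  refine ⟨LinearEquiv.ofFinrankEq _ _ ?_⟩
  rw [(e.submoduleMap K).finrank_eq, ← Subspace.dual_finrank_eq (V := V ⧸ W)]
  change _ = Module.finrank k (K.map e.toLinearMap)
  rw [he]
  exact W.dualQuotEquivDualAnnihilator.finrank_eq

end Duality

/-! ### The invariant form and the theorem -/

section Main

open Matrix

/-- The Lie algebra of a complex reductive group carries a nondegenerate bilinear form that is
invariant under the adjoint representation. -/
theorem IsComplexReductive.exists_invariant_form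
    {E : Type*} [NormedAddCommGroup E] [NormedSpace ℂ E] [FiniteDimensional ℂ E]
    {G : Type*} [TopologicalSpace G] [ChartedSpace E G] [Group G] [LieGroup 𝓘(ℂ, E) ω G]
    (hG : IsComplexReductive E G) :
    ∃ B : GroupLieAlgebra 𝓘(ℂ, E) G →ₗ[ℂ] GroupLieAlgebra 𝓘(ℂ, E) G →ₗ[ℂ] ℂ,
      (∀ w, (∀ v, B v w = 0) → w = 0) ∧
      ∀ g v w, B (adjointRep E G g v) (adjointRep E G g w) = B v w := by
  obtain ⟨n, ρ, hemb, hρ, himm, hred⟩ := hG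
  let δ := matrixDifferential (E := E) ρ
  have hinj : Function.Injective δ := by
    rw [← LinearMap.ker_eq_bot, LinearMap.ker_eq_bot']
    exact fun v hv => himm v fun i j => congrFun (congrFun hv i) j
  have hV : ∀ X, X ∈ LinearMap.range δ ↔ IsOneParameterGenerator ρ.range X := by
    refine fun X => ⟨?_, mem_range_matrixDifferential hρ hemb hinj⟩
    rintro ⟨v, rfl⟩
    exact isOneParameterGenerator_matrixDifferential hρ hred.isZariskiClosed v
  refine ⟨LinearMap.mk₂ ℂ (fun v w => trace (δ v * δ w)) ?_ ?_ ?_ ?_, ?_, ?_⟩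
  · intro v v' w
    rw [map_add, add_mul, trace_add]
  · intro c v w
    rw [map_smul, smul_mul_assoc, trace_smul]
  · intro v w w'
    rw [map_add, mul_add, trace_add]
  · intro c v w
    rw [map_smul, mul_smul_comm, trace_smul]
  · intro w hw
    refine (map_eq_zero_iff δ hinj).1 (hred.eq_zero_of_trace_eq_zero _ hV ⟨w, rfl⟩ ?_)
    rintro _ ⟨v, rfl⟩
    rw [trace_mul_comm]
    exact hw v
  · intro g v w
    change trace (δ (adLinear E G g v) * δ (adLinear E G g w)) = trace (δ v * δ w)
    have h1 : ∀ v, δ (adLinear E G g v) =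
        (ρ g : Matrix (Fin n) (Fin n) ℂ) * δ v * ((ρ g)⁻¹ : GL (Fin n) ℂ).1 := fun v => by
      rw [← map_inv]
      exact matrixDifferential_adLinear hρ g v
    rw [h1, h1, ← trace_units_conj (ρ g) (δ v * δ w)]
    congr 1
    simp only [mul_assoc, coe_units_inv]
    rw [← coe_units_inv, Units.inv_mul_cancel_left]

end Main

theorem proposition3p7
    {E : Type} [NormedAddCommGroup E] [NormedSpace ℂ E] [FiniteDimensional ℂ E]
    {G : Type*} [TopologicalSpace G] [ChartedSpace E G] [Group G] [LieGroup 𝓘(ℂ, E) ω G]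
    (hG : IsComplexReductive E G)
    {Γ : Type} [Group Γ] {h : ℕ} (hh : 1 ≤ h) (x : Fin h → Γ)
    (hx : IsNonorientableSurfaceGroup x) (φ : Γ →* G) :
    -- `A` is the Lie algebra of `G` on which `Γ` acts through `Ad ∘ φ`
    let A : Rep ℂ Γ := Rep.of ((adjointRep E G).comp φ)
    (A.ρ.invariants = ⨅ i, LinearMap.ker (adjointRep E G (φ (x i)) - 1) ∧
      Nonempty (groupCohomology A 0 ≃ₗ[ℂ]
        ↥(⨅ i, LinearMap.ker (adjointRep E G (φ (x i)) - 1)))) ∧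
    (2 ≤ h →
      Nonempty (groupCohomology A 2 ≃ₗ[ℂ]
        ↥(⨅ i, LinearMap.ker (adjointRep E G (φ (x i)) + 1)))) := by
  intro A
  have hinv : A.ρ.invariants = ⨅ i, LinearMap.ker (adjointRep E G (φ (x i)) - 1) :=
    hx.invariants_eq ((adjointRep E G).comp φ)
  refine ⟨⟨hinv, ⟨(groupCohomology.H0Iso A).toLinearEquiv ≪≫ₗ LinearEquiv.ofEq _ _ hinv⟩⟩,
    fun h2 => ?_⟩
  obtain ⟨e⟩ := hx.nonempty_H2_equiv h2 ((adjointRep E G).comp φ)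
  obtain ⟨B, hB, hBinv⟩ := hG.exists_invariant_form
  have : FiniteDimensional ℂ (GroupLieAlgebra 𝓘(ℂ, E) G) := inferInstanceAs (FiniteDimensional ℂ E)
  obtain ⟨e'⟩ := Submodule.nonempty_quotient_equiv_of_bilinear B hB
    (⨆ i, LinearMap.range (adjointRep E G (φ (x i)) + 1))
    (⨅ i, LinearMap.ker (adjointRep E G (φ (x i)) + 1)) (fun w => by
      -- With `g = Ad (φ (x i))`, invariance gives `B(gv, gw + w) = B(v + gv, w)`. As `g` is
      -- invertible, `w` is orthogonal to the image of `g + 1` exactly when `(g + 1) w = 0`.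
      have key : ∀ i v, B (adjointRep E G (φ (x i)) v) ((adjointRep E G (φ (x i)) + 1) w) =
          B ((adjointRep E G (φ (x i)) + 1) v) w := fun i v => by
        simp only [LinearMap.add_apply, Module.End.one_apply, map_add, hBinv]
        rw [add_comm]
      simp only [Submodule.mem_iInf, LinearMap.mem_ker]
      constructor
      · intro hw
        have hle : ⨆ i, LinearMap.range (adjointRep E G (φ (x i)) + 1) ≤
            LinearMap.ker (B.flip w) := by
          refine iSup_le fun i => ?_
          rintro _ ⟨v, rfl⟩
          rw [LinearMap.mem_ker, LinearMap.flip_apply, ← key, hw i, map_zero]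
        exact fun v hv => hle hv
      · intro hw i
        refine hB _ fun v => ?_
        rw [← Representation.self_inv_apply (adjointRep E G) (φ (x i)) v, key]
        exact hw _ (Submodule.mem_iSup_of_mem i ⟨_, rfl⟩))
  exact ⟨e ≪≫ₗ e'⟩
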